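/- Let $\zeta_n=\exp(2\pi i/n)$. A *fusion ring* is a free $\mathbb Z$-module with a finite basis $(b_i)_{i\in I}$ and an associative product $b_ib_j=\sum_k N_{i,j}^k b_k$, $N_{i,j}^k\in\mathbb Z_{\ge 0}$, with a neutral basis element $b_1$ and a duality $i\mapsto i^*$ such that $N_{i,k}^1=N_{k,i}^1=\delta_{i^*,k}$ and $N_{i,j}^k=N_{i^*,k}^j=N_{k,j^*}^i$. If it is commutative, its *eigentable* is the square table $(\lambda_{i,s})$ (unique up to permutation of the columns) for which the fusion matrices $M_i=(N_{i,j}^k)_{k,j}$ are simultaneously diagonalized as $\mathrm{diag}(\lambda_{i,s})_s$. The eigentable determines the fusion ring. For every integer $q\ge 2$ the *interpolated fusion ring* $\mathcal R_q$ is the commutative fusion ring whose eigentable is the following table (the generic character table of $\mathrm{PSL}(2,q)$, written for all integers $q \ge 2$; $c$ numbers the rows of a family, $k$ the columns, both from $1$). For $q$ even: $$\begin{array}{c|cccc} & 1 & 1 & 1\le k\le\frac{q-2}2 & 1\le k\le \frac q2\\ \hline 1 & 1&1&1&1\\ 1\le c\le\frac q2 & q-1&-1&0&-\zeta_{q+1}^{kc}-\zeta_{q+1}^{-kc}\\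 1 & q&0&1&-1\\ 1\le c\le\frac{q-2}2 & q+1&1&\zeta_{q-1}^{kc}+\zeta_{q-1}^{-kc}&0 \end{array}$$ For $q\equiv -1 \bmod 4$: $$\begin{array}{c|cccc} & 1 & 1\le k\le 2 & 1\le k\le\frac{q-3}4 & 1\le k\le \frac{q+1}4\\ \hline 1 & 1&1&1&1\\ 1\le c\le 2 & \frac{q-1}2&\frac{-1+i(-1)^{k+c}\sqrt q}2&0&(-1)^{k+1}\\ 1\le c\le\frac{q-3}4 & q-1&-1&0&-\zeta_{q+1}^{2kc}-\zeta_{q+1}^{-2kc}\\ 1 & q&0&1&-1\\ 1\le c\le\frac{q-3}4 & q+1&1&\zeta_{q-1}^{2kc}+\zeta_{q-1}^{-2kc}&0 \end{array}$$ For $q\equiv 1 \bmod 4$: $$\begin{array}{c|cccc} & 1 & 1\le k\le 2 & 1\le k\le\frac{q-1}4 & 1\le k\le \frac{q-1}4\\ \hline 1 & 1&1&1&1\\ 1\le c\le 2 & \frac{q+1}2&\frac{1+(-1)^{k+c}\sqrt q}2&(-1)^{k}&0\\ 1\le c\le\frac{q-1}4 & q-1&-1&0&-\zeta_{q+1}^{2kc}-\zeta_{q+1}^{-2kc}\\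 1 & q&0&1&-1\\ 1\le c\le\frac{q-5}4 & q+1&1&\zeta_{q-1}^{2kc}+\zeta_{q-1}^{-2kc}&0 \end{array}$$ A fusion ring *passes the zero spectrum criterion* if there are no indices $i_1,\dots,i_9$ satisfying all of the following conditions: $$N_{i_4,i_1}^{i_6},\ N_{i_5,i_4}^{i_2},\ N_{i_5,i_6}^{i_3},\ N_{i_7,i_9}^{i_1},\ N_{i_2,i_7}^{i_8},\ N_{i_8,i_9}^{i_3}\neq 0,$$ $$\sum_k N_{i_4,i_7}^kN_{i_5^*,i_8}^kN_{i_6,i_9^*}^k=0,\qquad N_{i_2,i_1}^{i_3}=1,$$ $$\sum_k N_{i_5,i_4}^kN_{i_3,i_1^*}^k=1\ \text{ or }\ \sum_k N_{i_2,i_4^*}^kN_{i_3,i_6^*}^k=1\ \text{ or }\ \sum_k N_{i_5^*,i_2}^kN_{i_6,i_1^*}^k=1,$$ $$\sum_k N_{i_2,i_7}^kN_{i_3,i_9^*}^k=1\ \text{ or }\ \sum_k N_{i_8,i_7^*}^kN_{i_3,i_1^*}^k=1\ \text{ or }\ \sum_k N_{i_2^*,i_8}^kN_{i_1,i_9^*}^k=1.$$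 **Proposition.** For every integer $q\ge 2$, the interpolated fusion ring $\mathcal R_q$ exists and passes the zero spectrum criterion. -/

import Mathlib

/-- A fusion ring with basis indexed by the finite type `ι`: `N i j k` is the coefficient
`N_{i,j}^k` of `b_k` in `b_i b_j`, `one` is the index of the neutral element and `dual` is the
duality `i ↦ i^*`. -/
structure FusionRing (ι : Type*) [Fintype ι] [DecidableEq ι] where
  /-- the fusion coefficients -/
  N : ι → ι → ι → ℕ
  /-- the index of the neutral basis element -/
  one : ι
  /-- the duality -/
  dual : ι → ι
  assoc : ∀ i j k m, ∑ l, N i j l * N l k m = ∑ l, N j k l * N i l m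
  one_mul : ∀ i k, N one i k = if k = i then 1 else 0
  mul_one : ∀ i k, N i one k = if k = i then 1 else 0
  mul_dual : ∀ i k, N i k one = if k = dual i then 1 else 0
  dual_mul : ∀ i k, N k i one = if k = dual i then 1 else 0
  frobenius_left : ∀ i j k, N i j k = N (dual i) k j
  frobenius_right : ∀ i j k, N i j k = N k (dual j) i

namespace FusionRing

variable {ι : Type*} [Fintype ι] [DecidableEq ι]

/-- The fusion ring is commutative. -/
def IsCommutative (F : FusionRing ι) : Prop :=
  ∀ i j k, F.N i j k = F.N j i k

/-- The fusion matrix `M_i = (N_{i,j}^k)_{k,j}`, i.e. the matrix of left multiplication by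
`b_i`. -/
def fusionMatrix (F : FusionRing ι) (i : ι) : Matrix ι ι ℂ :=
  Matrix.of fun k j => (F.N i j k : ℂ)

/-- `T` is an eigentable of the commutative fusion ring `F`: the fusion matrices are
simultaneously diagonalized as `P⁻¹ M_i P = diag (T i s)_s`. The columns of `T` are indexed by
`κ`; they are determined up to a permutation. -/
def IsEigentable (F : FusionRing ι) {κ : Type*} [Fintype κ] [DecidableEq κ]
    (T : ι → κ → ℂ) : Prop :=
  F.IsCommutative ∧
    ∃ (P : Matrix ι κ ℂ) (Q : Matrix κ ι ℂ), P * Q = 1 ∧ Q * P = 1 ∧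
      ∀ i, Q * F.fusionMatrix i * P = Matrix.diagonal (T i)

/-- The sum `∑_k N_{a,b}^k N_{c,d}^k`. -/
def pairing (F : FusionRing ι) (a b c d : ι) : ℕ :=
  ∑ k, F.N a b k * F.N c d k

/-- The indices `i₁, …, i₉` satisfy all the hypotheses of the zero spectrum criterion (under
which the fusion ring is not the Grothendieck ring of a fusion category over any field). -/
structure ZeroSpectrumObstruction (F : FusionRing ι) (i₁ i₂ i₃ i₄ i₅ i₆ i₇ i₈ i₉ : ι) :
    Prop where
  nonvanishing : F.N i₄ i₁ i₆ ≠ 0 ∧ F.N i₅ i₄ i₂ ≠ 0 ∧ F.N i₅ i₆ i₃ ≠ 0 ∧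
    F.N i₇ i₉ i₁ ≠ 0 ∧ F.N i₂ i₇ i₈ ≠ 0 ∧ F.N i₈ i₉ i₃ ≠ 0
  vanishing : ∑ k, F.N i₄ i₇ k * F.N (F.dual i₅) i₈ k * F.N i₆ (F.dual i₉) k = 0
  eq_one : F.N i₂ i₁ i₃ = 1
  first_alternative :
    F.pairing i₅ i₄ i₃ (F.dual i₁) = 1 ∨
    F.pairing i₂ (F.dual i₄) i₃ (F.dual i₆) = 1 ∨
    F.pairing (F.dual i₅) i₂ i₆ (F.dual i₁) = 1
  second_alternative :
    F.pairing i₂ i₇ i₃ (F.dual i₉) = 1 ∨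
    F.pairing i₈ (F.dual i₇) i₃ (F.dual i₁) = 1 ∨
    F.pairing (F.dual i₂) i₈ i₁ (F.dual i₉) = 1

/-- The fusion ring passes the zero spectrum criterion: it is not excluded by it. -/
def PassesZeroSpectrumCriterion (F : FusionRing ι) : Prop :=
  ¬ ∃ i₁ i₂ i₃ i₄ i₅ i₆ i₇ i₈ i₉ : ι, F.ZeroSpectrumObstruction i₁ i₂ i₃ i₄ i₅ i₆ i₇ i₈ i₉

end FusionRing

namespace InterpolatedPSL2

/-- Labels of the rows of the generic character table of `PSL(2,q)`: the trivial character,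
`h` characters of degree `(q ± 1)/2`, `m` characters of degree `q - 1`, the character of degree
`q`, and `p` characters of degree `q + 1`. -/
inductive Row (h m p : ℕ) : Type
  | triv : Row h m p
  | half (c : Fin h) : Row h m p
  | minus (c : Fin m) : Row h m p
  | steinberg : Row h m p
  | plus (c : Fin p) : Row h m p

/-- Labels of the columns of the generic character table of `PSL(2,q)`: the trivial class, and
three families of classes with `u`, `s` and `n` members. -/
inductive Col (u s n : ℕ) : Type
  | triv : Col u s n
  | unipotent (k : Fin u) : Col u s n
  | split (k : Fin s) : Col u s n
  | nonsplit (k : Fin n) : Col u s n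
  deriving DecidableEq, Fintype

/-- The root of unity `ζ_n = exp (2 π i / n)`. -/
noncomputable def zeta (n : ℕ) : ℂ :=
  Complex.exp (2 * Real.pi * Complex.I / n)

/-- The number `ζ_n^a + ζ_n^{-a}`. -/
noncomputable def zetaSum (n a : ℕ) : ℂ :=
  zeta n ^ (a : ℤ) + zeta n ^ (-(a : ℤ))

/-- The generic character table of `PSL(2,q)` for `q` even, interpolated to every even integer.
The parameters `c`, `k` of a row and a column start from `1` on paper and from `0` here. -/
noncomputable def tableEven (q : ℕ) :
    Row 0 (q / 2) ((q - 2) / 2) → Col 1 ((q - 2) / 2) (q / 2) → ℂ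
  | .triv, _ => 1
  | .half c, _ => c.elim0
  | .minus _, .triv => q - 1
  | .minus _, .unipotent _ => -1
  | .minus _, .split _ => 0
  | .minus c, .nonsplit k => -zetaSum (q + 1) ((k + 1) * (c + 1))
  | .steinberg, .triv => q
  | .steinberg, .unipotent _ => 0
  | .steinberg, .split _ => 1
  | .steinberg, .nonsplit _ => -1
  | .plus _, .triv => q + 1
  | .plus _, .unipotent _ => 1
  | .plus c, .split k => zetaSum (q - 1) ((k + 1) * (c + 1))
  | .plus _, .nonsplit _ => 0

/-- The generic character table of `PSL(2,q)` for `q ≡ -1 mod 4`, interpolated to every such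
integer. The last column `k = (q + 1) / 4`, usually displayed apart because its class size is
different, is included in the family `nonsplit`: there `-ζ_{q+1}^{2kc} - ζ_{q+1}^{-2kc}` equals
`-2 (-1)^c`. -/
noncomputable def tableThreeModFour (q : ℕ) :
    Row 2 ((q - 3) / 4) ((q - 3) / 4) → Col 2 ((q - 3) / 4) ((q + 1) / 4) → ℂ
  | .triv, _ => 1
  | .half _, .triv => (q - 1) / 2
  | .half c, .unipotent k =>
      (-1 + Complex.I * (-1) ^ ((k + 1 : ℕ) + (c + 1 : ℕ)) * (Real.sqrt q : ℂ)) / 2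
  | .half _, .split _ => 0
  | .half _, .nonsplit k => (-1) ^ ((k + 1 : ℕ) + 1)
  | .minus _, .triv => q - 1
  | .minus _, .unipotent _ => -1
  | .minus _, .split _ => 0
  | .minus c, .nonsplit k => -zetaSum (q + 1) (2 * (k + 1) * (c + 1))
  | .steinberg, .triv => q
  | .steinberg, .unipotent _ => 0
  | .steinberg, .split _ => 1
  | .steinberg, .nonsplit _ => -1
  | .plus _, .triv => q + 1
  | .plus _, .unipotent _ => 1
  | .plus c, .split k => zetaSum (q - 1) (2 * (k + 1) * (c + 1))
  | .plus _, .nonsplit _ => 0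

/-- The generic character table of `PSL(2,q)` for `q ≡ 1 mod 4`, interpolated to every such
integer `q ≥ 5`. The column `k = (q - 1) / 4`, usually displayed apart because its class size is
different, is included in the family `split`: there `ζ_{q-1}^{2kc} + ζ_{q-1}^{-2kc}` equals
`2 (-1)^c`. -/
noncomputable def tableOneModFour (q : ℕ) :
    Row 2 ((q - 1) / 4) ((q - 5) / 4) → Col 2 ((q - 1) / 4) ((q - 1) / 4) → ℂ
  | .triv, _ => 1
  | .half _, .triv => (q + 1) / 2
  | .half c, .unipotent k =>
      (1 + (-1) ^ ((k + 1 : ℕ) + (c + 1 : ℕ)) * (Real.sqrt q : ℂ)) / 2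
  | .half _, .split k => (-1) ^ (k + 1 : ℕ)
  | .half _, .nonsplit _ => 0
  | .minus _, .triv => q - 1
  | .minus _, .unipotent _ => -1
  | .minus _, .split _ => 0
  | .minus c, .nonsplit k => -zetaSum (q + 1) (2 * (k + 1) * (c + 1))
  | .steinberg, .triv => q
  | .steinberg, .unipotent _ => 0
  | .steinberg, .split _ => 1
  | .steinberg, .nonsplit _ => -1
  | .plus _, .triv => q + 1
  | .plus _, .unipotent _ => 1
  | .plus c, .split k => zetaSum (q - 1) (2 * (k + 1) * (c + 1))
  | .plus _, .nonsplit _ => 0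

/-- `F` is the interpolated fusion ring `R_q`: up to a labelling of its basis, its eigentable is
the interpolated generic character table of `PSL(2,q)`. (An eigentable determines the fusion
coefficients, so this pins down `F` up to a labelling of its basis.) -/
def IsInterpolatedFusionRing (q : ℕ) {ι : Type*} [Fintype ι] [DecidableEq ι]
    (F : FusionRing ι) : Prop :=
  (q % 2 = 0 ∧ ∃ e : ι ≃ Row 0 (q / 2) ((q - 2) / 2),
    F.IsEigentable fun i => tableEven q (e i)) ∨
  (q % 4 = 3 ∧ ∃ e : ι ≃ Row 2 ((q - 3) / 4) ((q - 3) / 4),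
    F.IsEigentable fun i => tableThreeModFour q (e i)) ∨
  (q % 4 = 1 ∧ ∃ e : ι ≃ Row 2 ((q - 1) / 4) ((q - 5) / 4),
    F.IsEigentable fun i => tableOneModFour q (e i))

end InterpolatedPSL2

/-! The table behaves like the character table of a group even when q is not a prime power. Weight
each column by the reciprocal of the generic centralizer order. Then the rows are orthonormal,
complex conjugation permutes them, and the weighted sum of a product of three rows is a natural
number n(i,j,k). `IsFusionTable` records exactly this. Such a table is the eigentable of a fusion
ring with N_{i,j}^k = n(i,j,k*), associativity being the symmetry of the fourfold sum, and of no
other fusion ring (`eq_toFusionRing`).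

Integrality is obtained without a group. On the split and on the nonsplit columns every row is, up
to a sign, a sum of characters of a cyclic group. A triple sum over such columns therefore counts
zero-sum triples of exponents, minus the contribution of the identity. That contribution is a
rational function of q which the trivial and unipotent columns cancel up to a small constant,
`excess`. Evenness and nonnegativity of 2n are then linear arithmetic (`doubleMult_even_nonneg`).

For the criterion, a trivial index in an obstruction would force a nonzero term in the triple sum
(`obstruction_ne_triv`). Among nontrivial indices there are two ways out. If one nontrivial row
occurs in all products of nontrivial rows, the triple sum cannot vanish: a row of degree q+1 works
for even q ≥ 4, and the Steinberg row for q ≡ 1 mod 4. For q ≡ 3 mod 4 there is no such row, because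
the square of a half-degree row and its product with its dual have no common constituent. There, for
q ≥ 15, no fourfold product of nontrivial rows contains the trivial row exactly once, so the "= 1"
alternatives fail. The remaining values q = 2, 3, 7, 11 are settled by exhaustive search. -/

namespace FusionRing

/-! ### Relabelling the basis -/

section Map

variable {ι ι' κ : Type*} [Fintype ι] [DecidableEq ι] [Fintype ι'] [DecidableEq ι']
  [Fintype κ] [DecidableEq κ]

/-- Relabelling of the basis of a fusion ring. -/
def map (F : FusionRing ι) (e : ι ≃ ι') : FusionRing ι' where
  N i j k := F.N (e.symm i) (e.symm j) (e.symm k)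
  one := e F.one
  dual i := e (F.dual (e.symm i))
  assoc i j k m := by
    rw [Equiv.sum_comp e.symm fun l => F.N (e.symm i) (e.symm j) l * F.N l (e.symm k) (e.symm m),
      Equiv.sum_comp e.symm fun l => F.N (e.symm j) (e.symm k) l * F.N (e.symm i) l (e.symm m)]
    exact F.assoc _ _ _ _
  one_mul i k := by simp [F.one_mul]
  mul_one i k := by simp [F.mul_one]
  mul_dual i k := by simp [F.mul_dual, Equiv.symm_apply_eq]
  dual_mul i k := by simp [F.dual_mul, Equiv.symm_apply_eq]
  frobenius_left i j k := by simpa using F.frobenius_left _ _ _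
  frobenius_right i j k := by simpa using F.frobenius_right _ _ _

theorem IsEigentable.map {F : FusionRing ι} {e : ι ≃ ι'} {T : ι' → κ → ℂ}
    (h : F.IsEigentable fun i => T (e i)) : (F.map e).IsEigentable T := by
  obtain ⟨hc, P, Q, hPQ, hQP, hD⟩ := h
  refine ⟨fun i j k => hc _ _ _, P.submatrix e.symm id, Q.submatrix id e.symm, ?_, ?_, fun i => ?_⟩
  · have := Matrix.submatrix_mul_equiv P Q e.symm (Equiv.refl κ) e.symm
    rw [Equiv.coe_refl] at this
    rw [this, hPQ]
    simp
  · rw [Matrix.submatrix_mul_equiv Q P id e.symm id, hQP]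
    simp
  · have h1 : (F.map e).fusionMatrix i
        = (F.fusionMatrix (e.symm i)).submatrix e.symm e.symm := rfl
    rw [h1, Matrix.submatrix_mul_equiv, Matrix.submatrix_mul_equiv, hD]
    simp

theorem PassesZeroSpectrumCriterion.of_map {F : FusionRing ι} {e : ι ≃ ι'}
    (h : (F.map e).PassesZeroSpectrumCriterion) : F.PassesZeroSpectrumCriterion := by
  rintro ⟨i₁, i₂, i₃, i₄, i₅, i₆, i₇, i₈, i₉, H⟩
  have hp : ∀ a b c d, (F.map e).pairing (e a) (e b) (e c) (e d) = F.pairing a b c d := by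
    intro a b c d
    simp only [pairing, FusionRing.map, Equiv.symm_apply_apply]
    exact Equiv.sum_comp e.symm fun k => F.N a b k * F.N c d k
  have hd : ∀ a, (F.map e).dual (e a) = e (F.dual a) := by
    intro a; simp [FusionRing.map]
  have hN : ∀ a b c, (F.map e).N (e a) (e b) (e c) = F.N a b c := by
    intro a b c; simp [FusionRing.map]
  refine h ⟨e i₁, e i₂, e i₃, e i₄, e i₅, e i₆, e i₇, e i₈, e i₉, ?_, ?_, ?_, ?_, ?_⟩
  · simpa only [hN] using H.nonvanishing
  · simp only [hd]
    rw [← H.vanishing, ← Equiv.sum_comp e]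
    simp only [hN]
  · simpa only [hN] using H.eq_one
  · simpa only [hd, hp] using H.first_alternative
  · simpa only [hd, hp] using H.second_alternative

end Map

/-! ### Fusion rings from orthonormal tables -/

variable {R κ : Type*} [Fintype R] [DecidableEq R] [Fintype κ]

/-- A square table `T` with column weights `w`, a row `t` of ones, complex conjugation acting on the
rows by `d`, and weighted triple sums of rows given by natural numbers `n` that make the rows
orthonormal. -/
structure IsFusionTable (T : R → κ → ℂ) (w : κ → ℝ) (t : R) (d : R → R)
    (n : R → R → R → ℕ) : Prop where
  card_eq : Fintype.card R = Fintype.card κ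
  triv : ∀ s, T t s = 1
  conj : ∀ i s, star (T i s) = T (d i) s
  dual_dual : ∀ i, d (d i) = i
  triple : ∀ i j k, ∑ s, (w s : ℂ) * (T i s * T j s * T k s) = n i j k
  triv_coeff : ∀ i j, n t i j = if j = d i then 1 else 0

namespace IsFusionTable

variable {T : R → κ → ℂ} {w : κ → ℝ} {t : R} {d : R → R} {n : R → R → R → ℕ}

theorem swap_left (h : IsFusionTable T w t d n) (i j k : R) : n i j k = n j i k := by
  have : (n i j k : ℂ) = n j i k := by
    rw [← h.triple, ← h.triple]
    exact Finset.sum_congr rfl fun s _ => by ring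
  exact_mod_cast this

theorem swap_right (h : IsFusionTable T w t d n) (i j k : R) : n i j k = n i k j := by
  have : (n i j k : ℂ) = n i k j := by
    rw [← h.triple, ← h.triple]
    exact Finset.sum_congr rfl fun s _ => by ring
  exact_mod_cast this

/-- The weights are real and a triple sum is a natural number, so it equals its own conjugate, and
conjugation replaces each row by its dual. -/
theorem dual_coeff (h : IsFusionTable T w t d n) (i j k : R) :
    n (d i) (d j) (d k) = n i j k := by
  have : (n (d i) (d j) (d k) : ℂ) = n i j k := by
    rw [← h.triple, ← Complex.conj_natCast (n i j k), ← h.triple, map_sum]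
    refine Finset.sum_congr rfl fun s _ => ?_
    simp only [map_mul, Complex.conj_ofReal, ← h.conj]
    rfl
  exact_mod_cast this

theorem dual_eq_iff (h : IsFusionTable T w t d n) {i j : R} : d i = d j ↔ i = j :=
  (Function.LeftInverse.injective h.dual_dual).eq_iff

theorem orthonormal (h : IsFusionTable T w t d n) (i j : R) :
    ∑ s, (w s : ℂ) * (T i s * T j s) = if j = d i then 1 else 0 := by
  have := h.triple t i j
  rw [h.triv_coeff] at this
  simpa [h.triv] using this

theorem injective (h : IsFusionTable T w t d n) {i j : R} (hij : T i = T j) : i = j := by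
  have h1 := h.orthonormal i (d i)
  rw [hij, h.orthonormal j (d i)] at h1
  simpa [h.dual_eq_iff] using h1

theorem dual_triv (h : IsFusionTable T w t d n) : d t = t := by
  refine h.injective (funext fun s => ?_)
  rw [← h.conj, h.triv, star_one]

variable [DecidableEq κ]

/-- Row orthonormality says that the table has a right inverse; the table being square, this is also
a left inverse, which is column orthogonality. -/
theorem mul_inverse (h : IsFusionTable T w t d n) :
    (Matrix.of fun s j => (w s : ℂ) * T (d j) s : Matrix κ R ℂ) * (Matrix.of T : Matrix R κ ℂ)
      = 1 := by
  rw [← Matrix.mul_eq_one_comm_of_card_eq _ _ _ h.card_eq]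
  ext i j
  simp only [Matrix.mul_apply, Matrix.of_apply, Matrix.one_apply]
  have h1 := h.orthonormal i (d j)
  simp only [h.dual_eq_iff, eq_comm (a := j)] at h1
  rw [← h1]
  exact Finset.sum_congr rfl fun s _ => by ring

/-- The expansion of a function on the columns in the rows of the table. -/
theorem expansion (h : IsFusionTable T w t d n) (f : κ → ℂ) (s : κ) :
    ∑ k, (∑ u, (w u : ℂ) * (f u * T (d k) u)) * T k s = f s := by
  have h1 : ∀ u, ∑ k, (w u : ℂ) * T (d k) u * T k s = if u = s then 1 else 0 := by
    intro u
    have := congrFun (congrFun h.mul_inverse u) s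
    simpa [Matrix.mul_apply, Matrix.one_apply] using this
  calc ∑ k, (∑ u, (w u : ℂ) * (f u * T (d k) u)) * T k s
      = ∑ u, f u * ∑ k, (w u : ℂ) * T (d k) u * T k s := by
        simp only [Finset.sum_mul, Finset.mul_sum]
        rw [Finset.sum_comm]
        exact Finset.sum_congr rfl fun u _ => Finset.sum_congr rfl fun k _ => by ring
    _ = f s := by simp [h1]

theorem mul_eq_sum (h : IsFusionTable T w t d n) (i j : R) (s : κ) :
    T i s * T j s = ∑ k, (n i j (d k) : ℂ) * T k s := by
  rw [← h.expansion (fun u => T i u * T j u) s]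
  exact Finset.sum_congr rfl fun k _ => by rw [h.triple]

/-- The contraction of two triple sums is a fourfold sum. -/
theorem contraction (h : IsFusionTable T w t d n) (a b c e : R) :
    ((∑ k, n a b (d k) * n k c e : ℕ) : ℂ)
      = ∑ s, (w s : ℂ) * (T a s * T b s * T c s * T e s) := by
  push_cast
  have : ∀ s, (w s : ℂ) * (T a s * T b s * T c s * T e s)
      = ∑ k, (n a b (d k) : ℂ) * ((w s : ℂ) * (T k s * T c s * T e s)) := by
    intro s
    rw [h.mul_eq_sum a b s]
    simp only [Finset.sum_mul, Finset.mul_sum]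
    exact Finset.sum_congr rfl fun k _ => by ring
  rw [Finset.sum_congr rfl fun s _ => this s, Finset.sum_comm]
  refine Finset.sum_congr rfl fun k _ => ?_
  rw [← Finset.mul_sum, h.triple]

/-- This becomes associativity: both bracketings equal the same symmetric fourfold sum. -/
theorem contraction_comm (h : IsFusionTable T w t d n) (a b c e : R) :
    ∑ k, n a b (d k) * n k c e = ∑ k, n b c (d k) * n a k e := by
  have : ((∑ k, n a b (d k) * n k c e : ℕ) : ℂ) = (∑ k, n b c (d k) * n a k e : ℕ) := by
    have h2 : ∑ k, n b c (d k) * n a k e = ∑ k, n b c (d k) * n k a e :=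
      Finset.sum_congr rfl fun k _ => by rw [h.swap_left a k e]
    rw [h2, h.contraction, h.contraction]
    exact Finset.sum_congr rfl fun s _ => by ring
  exact_mod_cast this

/-- The fusion ring whose eigentable is `T`. -/
def toFusionRing (h : IsFusionTable T w t d n) : FusionRing R where
  -- The coefficient of row k in a product is its inner product with row k, whose conjugate is row
  -- `d k`.
  N i j k := n i j (d k)
  one := t
  dual := d
  assoc i j k m := h.contraction_comm i j k (d m)
  one_mul i k := by simp [h.triv_coeff, h.dual_eq_iff]
  mul_one i k := by simp [h.swap_left i t, h.triv_coeff, h.dual_eq_iff]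
  mul_dual i k := by
    rw [h.dual_triv, h.swap_right, h.swap_left, h.triv_coeff]
  dual_mul i k := by
    rw [h.dual_triv, h.swap_left, h.swap_right, h.swap_left, h.triv_coeff]
  frobenius_left i j k := by
    rw [← h.dual_coeff i j, h.dual_dual, h.swap_right]
  frobenius_right i j k := by
    rw [← h.dual_coeff i j, h.dual_dual, h.swap_left, h.swap_right, h.swap_left, h.swap_right,
      h.swap_left]

theorem isEigentable (h : IsFusionTable T w t d n) : h.toFusionRing.IsEigentable T := by
  refine ⟨fun i j k => h.swap_left i j (d k),
    (Matrix.of fun s j => (w s : ℂ) * T (d j) s : Matrix κ R ℂ).transpose,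
    (Matrix.of T : Matrix R κ ℂ).transpose, ?_, ?_, fun i => ?_⟩
  · rw [← Matrix.transpose_mul, (Matrix.mul_eq_one_comm_of_card_eq _ _ _ h.card_eq).2 h.mul_inverse,
      Matrix.transpose_one]
  · rw [← Matrix.transpose_mul, h.mul_inverse, Matrix.transpose_one]
  · have h1 : (Matrix.of T : Matrix R κ ℂ).transpose * h.toFusionRing.fusionMatrix i
        = Matrix.diagonal (T i) * (Matrix.of T : Matrix R κ ℂ).transpose := by
      ext s j
      rw [Matrix.diagonal_mul, Matrix.mul_apply]
      simp only [Matrix.transpose_apply, Matrix.of_apply, fusionMatrix, toFusionRing]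
      rw [h.mul_eq_sum]
      exact Finset.sum_congr rfl fun k _ => by ring
    rw [h1, Matrix.mul_assoc, ← Matrix.transpose_mul, h.mul_inverse, Matrix.transpose_one,
      Matrix.mul_one]

/-- The eigentable determines the fusion ring. -/
theorem eq_toFusionRing (h : IsFusionTable T w t d n) {F : FusionRing R}
    (hF : F.IsEigentable T) : F = h.toFusionRing := by
  obtain ⟨-, P, Q, hPQ, hQP, hD⟩ := hF
  have hmul : ∀ i j, F.fusionMatrix i * F.fusionMatrix j
      = ∑ l, (F.N i j l : ℂ) • F.fusionMatrix l := by
    intro i j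
    ext m k
    simp only [Matrix.mul_apply, Matrix.sum_apply, Matrix.smul_apply, fusionMatrix,
      Matrix.of_apply, smul_eq_mul]
    have := congrArg (Nat.cast : ℕ → ℂ) (F.assoc i j k m)
    push_cast at this
    rw [this]
    exact Finset.sum_congr rfl fun l _ => mul_comm _ _
  -- Diagonalizing the multiplication rule of the fusion matrices shows that each column is a
  -- character of `F`; orthonormality of the rows then isolates each coefficient.
  have hT : ∀ i j s, T i s * T j s = ∑ l, (F.N i j l : ℂ) * T l s := by
    intro i j s
    have h1 : Matrix.diagonal (T i) * Matrix.diagonal (T j)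
        = ∑ l, (F.N i j l : ℂ) • Matrix.diagonal (T l) := by
      rw [← hD, ← hD, show Q * F.fusionMatrix i * P * (Q * F.fusionMatrix j * P)
        = Q * (F.fusionMatrix i * (P * Q) * F.fusionMatrix j) * P by simp only [Matrix.mul_assoc],
        hPQ, Matrix.mul_one, hmul, Matrix.mul_sum, Matrix.sum_mul]
      refine Finset.sum_congr rfl fun l _ => ?_
      rw [← hD, Matrix.mul_smul, Matrix.smul_mul]
    have h2 := congrFun (congrFun h1 s) s
    simpa [Matrix.sum_apply] using h2
  have hN : ∀ i j k, F.N i j k = n i j (d k) := by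
    intro i j k
    have h1 : (F.N i j k : ℂ) = n i j (d k) := by
      rw [← h.triple]
      simp only [hT, Finset.sum_mul, Finset.mul_sum]
      rw [Finset.sum_comm]
      have : ∀ l, ∑ s, (w s : ℂ) * ((F.N i j l : ℂ) * T l s * T (d k) s)
          = (F.N i j l : ℂ) * if d k = d l then 1 else 0 := by
        intro l
        rw [← h.orthonormal, Finset.mul_sum]
        exact Finset.sum_congr rfl fun s _ => by ring
      simp [this, h.dual_eq_iff]
    exact_mod_cast h1
  have hone : F.one = t := by
    have h1 := F.mul_one t t
    rw [hN, h.triv_coeff, if_pos rfl] at h1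
    simpa [h.dual_eq_iff, eq_comm] using h1
  have hdual : F.dual = d := by
    funext i
    have h1 := F.mul_dual i (d i)
    rw [hN, hone, h.dual_triv, h.swap_right, h.swap_left, h.triv_coeff, if_pos rfl] at h1
    by_contra hne
    rw [if_neg (Ne.symm hne)] at h1
    exact one_ne_zero h1
  cases F
  simp only [toFusionRing, FusionRing.mk.injEq]
  exact ⟨funext fun i => funext fun j => funext fun k => hN i j k, hone, hdual⟩

end IsFusionTable

end FusionRing

/-! ### The zero spectrum criterion for a fusion table -/

namespace FusionRing

namespace IsFusionTable

variable {R κ : Type*} [Fintype R] [DecidableEq R] [Fintype κ]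
  {T : R → κ → ℂ} {w : κ → ℝ} {t : R} {d : R → R} {n : R → R → R → ℕ}

theorem triv_left_ne_zero (h : IsFusionTable T w t d n) {i j : R} : n t i j ≠ 0 ↔ j = d i := by
  simp [h.triv_coeff]

theorem triv_mid_ne_zero (h : IsFusionTable T w t d n) {i j : R} : n i t j ≠ 0 ↔ j = d i := by
  rw [h.swap_left, h.triv_left_ne_zero]

theorem triv_right_ne_zero (h : IsFusionTable T w t d n) {i j : R} : n i j t ≠ 0 ↔ j = d i := by
  rw [h.swap_right, h.triv_mid_ne_zero]

theorem dual_coeff_left (h : IsFusionTable T w t d n) (i j k : R) :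
    n (d i) j k = n i (d j) (d k) := by
  rw [← h.dual_coeff i, h.dual_dual, h.dual_dual]

theorem contraction_swap_left (h : IsFusionTable T w t d n) (a b c e : R) :
    ∑ k, n a b (d k) * n k c e = ∑ k, n b a (d k) * n k c e := by
  simp only [h.swap_left a b]

variable [DecidableEq κ]

/-- A nonzero term in one bracketing makes the natural number computed by both bracketings nonzero,
so the other one has a nonzero term too. -/
theorem crossing (h : IsFusionTable T w t d n) {a b c e m : R} (h₁ : n a b (d m) ≠ 0)
    (h₂ : n m c e ≠ 0) : ∃ k, n b c (d k) ≠ 0 ∧ n a k e ≠ 0 := by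
  have h3 : ∑ k, n a b (d k) * n k c e ≠ 0 := fun h0 =>
    mul_ne_zero h₁ h₂ (Finset.sum_eq_zero_iff.1 h0 m (Finset.mem_univ m))
  rw [h.contraction_comm] at h3
  obtain ⟨k, -, hk⟩ := Finset.exists_ne_zero_of_sum_ne_zero h3
  exact ⟨k, mul_ne_zero_iff.1 hk⟩

/-- All terms of the triple sum are natural numbers, so a single nonzero one contradicts its
vanishing. The middle factor is dualized so that i₅ appears without a dual. -/
theorem not_vanishing (h : IsFusionTable T w t d n) {i₁ i₂ i₃ i₄ i₅ i₆ i₇ i₈ i₉ : R}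
    (H : h.toFusionRing.ZeroSpectrumObstruction i₁ i₂ i₃ i₄ i₅ i₆ i₇ i₈ i₉) (k : R)
    (h₁ : n i₄ i₇ (d k) ≠ 0) (h₂ : n i₅ (d i₈) k ≠ 0) (h₃ : n i₆ (d i₉) (d k) ≠ 0) : False := by
  have h0 := Finset.sum_eq_zero_iff.1 H.vanishing k (Finset.mem_univ k)
  refine mul_ne_zero (mul_ne_zero h₁ ?_) h₃ h0
  change n (d i₅) i₈ (d k) ≠ 0
  rwa [h.dual_coeff_left, h.dual_dual]

/-- The trivial index does not occur in an obstruction. -/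
theorem obstruction_ne_triv (h : IsFusionTable T w t d n) {i₁ i₂ i₃ i₄ i₅ i₆ i₇ i₈ i₉ : R}
    (H : h.toFusionRing.ZeroSpectrumObstruction i₁ i₂ i₃ i₄ i₅ i₆ i₇ i₈ i₉) :
    i₁ ≠ t ∧ i₂ ≠ t ∧ i₃ ≠ t ∧ i₄ ≠ t ∧ i₅ ≠ t ∧ i₆ ≠ t ∧ i₇ ≠ t ∧ i₈ ≠ t ∧ i₉ ≠ t := by
  obtain ⟨h1, h2, h3, h4, h5, h6⟩ : n i₄ i₁ (d i₆) ≠ 0 ∧ n i₅ i₄ (d i₂) ≠ 0 ∧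
    n i₅ i₆ (d i₃) ≠ 0 ∧ n i₇ i₉ (d i₁) ≠ 0 ∧ n i₂ i₇ (d i₈) ≠ 0 ∧ n i₈ i₉ (d i₃) ≠ 0 :=
    H.nonvanishing
  have h7 : n i₂ i₁ (d i₃) ≠ 0 := by
    have : n i₂ i₁ (d i₃) = 1 := H.eq_one
    omega
  have hsl := h.swap_left
  have key := h.not_vanishing H
  -- A trivial index identifies other indices through the nonvanishing conditions. If it is i₁, i₂
  -- or i₃, two factors of the triple sum coincide up to duality and `crossing` supplies k. If it is
  -- one of i₄ to i₉, one factor of the triple sum has a trivial entry and pins down k directly.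
  refine ⟨?_, ?_, ?_, ?_, ?_, ?_, ?_, ?_, ?_⟩ <;> rintro rfl
  · rw [h.triv_mid_ne_zero, h.dual_eq_iff] at h1 h7
    rw [h.dual_triv, h.triv_right_ne_zero] at h4
    subst h1 h7 h4
    obtain ⟨k, hk, hk'⟩ := h.crossing h2 h5
    refine key k hk ?_ ?_ <;> clear key H hsl <;>
      grind only [h.swap_left, h.swap_right, h.dual_dual, h.dual_coeff_left]
  · rw [h.triv_left_ne_zero, h.dual_eq_iff] at h5 h7
    rw [h.dual_triv, h.triv_right_ne_zero] at h2
    subst h5 h7 h2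
    rw [hsl] at h4 h1
    obtain ⟨k, hk, hk'⟩ := h.crossing h4 h1
    refine key k ?_ ?_ ?_ <;> clear key H hsl <;>
      grind only [h.swap_left, h.swap_right, h.dual_dual, h.dual_coeff_left]
  · rw [h.dual_triv, h.triv_right_ne_zero] at h3 h6 h7
    subst h3 h6 h7
    rw [hsl] at h4 h1
    obtain ⟨k, hk, hk'⟩ := h.crossing h4 h1
    refine key k ?_ ?_ ?_ <;> clear key H hsl <;>
      grind only [h.swap_left, h.swap_right, h.dual_dual, h.dual_coeff_left]
  · rw [h.triv_left_ne_zero, h.dual_eq_iff] at h1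
    rw [h.triv_mid_ne_zero, h.dual_eq_iff] at h2
    subst h1 h2
    refine key i₇ (h.triv_left_ne_zero.2 rfl) ?_ ?_ <;> clear key H hsl <;>
      grind only [h.swap_left, h.swap_right, h.dual_dual, h.dual_coeff_left]
  · rw [h.triv_left_ne_zero, h.dual_eq_iff] at h2 h3
    subst h2 h3
    refine key i₈ ?_ (h.triv_left_ne_zero.2 (h.dual_dual _).symm) ?_ <;> clear key H hsl <;>
      grind only [h.swap_left, h.swap_right, h.dual_dual, h.dual_coeff_left]
  · rw [h.dual_triv, h.triv_right_ne_zero] at h1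
    rw [h.triv_mid_ne_zero, h.dual_eq_iff] at h3
    subst h1 h3
    refine key (d i₉) ?_ ?_ (h.triv_left_ne_zero.2 rfl) <;> clear key H hsl <;>
      grind only [h.swap_left, h.swap_right, h.dual_dual, h.dual_coeff_left]
  · rw [h.triv_left_ne_zero, h.dual_eq_iff] at h4
    rw [h.triv_mid_ne_zero, h.dual_eq_iff] at h5
    subst h4 h5
    refine key i₄ (h.triv_mid_ne_zero.2 rfl) ?_ ?_ <;> clear key H hsl <;>
      grind only [h.swap_left, h.swap_right, h.dual_dual, h.dual_coeff_left]
  · rw [h.triv_left_ne_zero, h.dual_eq_iff] at h6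
    rw [h.dual_triv, h.triv_right_ne_zero] at h5
    subst h6 h5
    refine key (d i₅) ?_ (by rw [h.dual_triv, h.triv_mid_ne_zero]) ?_ <;> clear key H hsl <;>
      grind only [h.swap_left, h.swap_right, h.dual_dual, h.dual_coeff_left]
  · rw [h.triv_mid_ne_zero, h.dual_eq_iff] at h4 h6
    subst h4 h6
    refine key i₆ ?_ ?_ (by rw [h.dual_triv, h.triv_mid_ne_zero]) <;> clear key H hsl <;>
      grind only [h.swap_left, h.swap_right, h.dual_dual, h.dual_coeff_left]

/-- The criterion holds if a nontrivial index occurs in all products of nontrivial indices. -/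
theorem passes_of_universal (h : IsFusionTable T w t d n) (S : R)
    (hS : ∀ x y, x ≠ t → y ≠ t → n x y S ≠ 0) : h.toFusionRing.PassesZeroSpectrumCriterion := by
  rintro ⟨i₁, i₂, i₃, i₄, i₅, i₆, i₇, i₈, i₉, H⟩
  obtain ⟨-, -, -, h4, h5, h6, h7, h8, h9⟩ := h.obstruction_ne_triv H
  have hd : ∀ {x}, x ≠ t → d x ≠ t := by
    intro x hx h0
    rw [← h.dual_triv, h.dual_eq_iff] at h0
    exact hx h0
  -- The outer factors involve `d k`, hence the dual of `S` as witness.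
  refine h.not_vanishing H (d S) ?_ ?_ ?_
  · rw [h.dual_dual]; exact hS _ _ h4 h7
  · rw [← h.dual_coeff, h.dual_dual, h.dual_dual]; exact hS _ _ (hd h5) h8
  · rw [h.dual_dual]; exact hS _ _ h6 (hd h9)

/-- The criterion holds if no fourfold product of nontrivial indices contains the trivial index
exactly once. -/
theorem passes_of_contraction_ne_one (h : IsFusionTable T w t d n)
    (hQ : ∀ a b c e, a ≠ t → b ≠ t → c ≠ t → e ≠ t → ∑ k, n a b (d k) * n k c e ≠ 1) :
    h.toFusionRing.PassesZeroSpectrumCriterion := by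
  rintro ⟨i₁, i₂, i₃, i₄, i₅, i₆, i₇, i₈, i₉, H⟩
  obtain ⟨h1, h2, h3, h4, h5, h6, -, -, -⟩ := h.obstruction_ne_triv H
  have hd : ∀ {x}, x ≠ t → d x ≠ t := by
    intro x hx h0
    rw [← h.dual_triv, h.dual_eq_iff] at h0
    exact hx h0
  -- By Frobenius reciprocity each pairing in the criterion is a contraction with its last two
  -- indices dualized.
  have hp : ∀ a b c e, a ≠ t → b ≠ t → c ≠ t → e ≠ t → h.toFusionRing.pairing a b c e ≠ 1 := by
    intro a b c e ha hb hc he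
    convert hQ a b (d c) (d e) ha hb (hd hc) (hd he) using 2
    refine Finset.sum_congr rfl fun k _ => ?_
    change n a b (d k) * n c e (d k) = n a b (d k) * n k (d c) (d e)
    rw [← h.dual_coeff k, h.dual_dual, h.dual_dual, h.swap_left (d k), h.swap_right c (d k)]
  rcases H.first_alternative with h0 | h0 | h0
  · exact hp _ _ _ _ h5 h4 h3 (hd h1) h0
  · exact hp _ _ _ _ h2 (hd h4) h3 (hd h6) h0
  · exact hp _ _ _ _ (hd h5) h2 h6 (hd h1) h0

theorem contraction_swap_mid (h : IsFusionTable T w t d n) (a b c e : R) :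
    ∑ k, n a b (d k) * n k c e = ∑ k, n a c (d k) * n k b e := by
  have : ((∑ k, n a b (d k) * n k c e : ℕ) : ℂ) = (∑ k, n a c (d k) * n k b e : ℕ) := by
    rw [h.contraction, h.contraction]
    exact Finset.sum_congr rfl fun s _ => by ring
  exact_mod_cast this

theorem contraction_swap_outer (h : IsFusionTable T w t d n) (a b c e : R) :
    ∑ k, n a b (d k) * n k c e = ∑ k, n e b (d k) * n k c a := by
  have : ((∑ k, n a b (d k) * n k c e : ℕ) : ℂ) = (∑ k, n e b (d k) * n k c a : ℕ) := by
    rw [h.contraction, h.contraction]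
    exact Finset.sum_congr rfl fun s _ => by ring
  exact_mod_cast this

/-- Two distinct intermediate constituents already contribute at least 2. -/
theorem contraction_ne_one_of_ne (a b c e k l : R) (hkl : k ≠ l)
    (h₁ : n a b (d k) ≠ 0) (h₂ : n k c e ≠ 0) (h₃ : n a b (d l) ≠ 0) (h₄ : n l c e ≠ 0) :
    ∑ k, n a b (d k) * n k c e ≠ 1 := by
  have h5 : ∑ m ∈ ({k, l} : Finset R), n a b (d m) * n m c e ≤ ∑ m, n a b (d m) * n m c e :=
    Finset.sum_le_sum_of_subset (Finset.subset_univ _)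
  rw [Finset.sum_pair hkl] at h5
  have h6 := Nat.pos_of_ne_zero (mul_ne_zero h₁ h₂)
  have h7 := Nat.pos_of_ne_zero (mul_ne_zero h₃ h₄)
  omega

end IsFusionTable

end FusionRing

/-! ### Character sums over cyclic groups -/

namespace InterpolatedPSL2

/-- The indicator of `e ∈ {0, M, -M}`. -/
def wrap (M e : ℤ) : ℤ := if e = 0 ∨ e = M ∨ e = -M then 1 else 0

/-- The number of triples in `E × F × G` whose sum is `0` or `± M`. -/
def tripleCount (M : ℤ) (E F G : List ℤ) : ℤ :=
  (E.map fun a => (F.map fun b => (G.map fun c => wrap M (a + b + c)).sum).sum).sum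

/-- The character sum `∑_{e ∈ E} ζ_M^{j e}`. -/
noncomputable def expSum (M : ℕ) (E : List ℤ) (j : ℤ) : ℂ :=
  (E.map fun e => zeta M ^ (j * e)).sum

/-- The weight of the orbit `{k + 1, -(k + 1)}` of `ℤ/M` relative to an orbit of size `2`. -/
noncomputable def orbitWeight (M k : ℕ) : ℝ := if 2 * (k + 1) = M then 1 / 2 else 1

theorem zeta_isPrimitiveRoot {M : ℕ} (hM : M ≠ 0) : IsPrimitiveRoot (zeta M) M :=
  Complex.isPrimitiveRoot_exp M hM

theorem zeta_ne_zero (M : ℕ) : zeta M ≠ 0 := Complex.exp_ne_zero _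

/-- The geometric sum detects divisibility of e by M. In the given range the only multiples are 0
and ±M, so divisibility becomes the linear condition `wrap`. -/
theorem sum_zeta_zpow {M : ℕ} (hM : M ≠ 0) {e : ℤ} (he : |e| < 2 * M) :
    ∑ j ∈ Finset.range M, zeta M ^ ((j : ℤ) * e) = (M : ℂ) * (wrap M e : ℂ) := by
  have hz := zeta_isPrimitiveRoot hM
  have h1 : ∀ j : ℕ, zeta M ^ ((j : ℤ) * e) = (zeta M ^ e) ^ j := by
    intro j
    rw [mul_comm, zpow_mul, zpow_natCast]
  simp only [h1]
  have hM' : (0 : ℤ) < M := by omega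
  by_cases hd : (M : ℤ) ∣ e
  · have hw : wrap M e = 1 := by
      obtain ⟨c, rfl⟩ := hd
      rw [abs_mul, abs_of_pos hM', mul_comm] at he
      have hc : |c| < 2 := lt_of_mul_lt_mul_right he hM'.le
      rw [abs_lt] at hc
      obtain ⟨h2, h3⟩ := hc
      have : c = -1 ∨ c = 0 ∨ c = 1 := by omega
      rcases this with rfl | rfl | rfl <;> simp [wrap]
    rw [(hz.zpow_eq_one_iff_dvd e).2 hd, hw]
    simp
  · have hw : wrap M e = 0 := by
      rw [wrap, if_neg]
      rintro (rfl | rfl | rfl) <;> simp at hd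
    have hne : zeta M ^ e ≠ 1 := fun h => hd ((hz.zpow_eq_one_iff_dvd e).1 h)
    rw [geom_sum_eq hne, ← zpow_natCast, ← zpow_mul, mul_comm, zpow_mul, zpow_natCast, hz.pow_eq_one,
      one_zpow, hw]
    simp

theorem sum_expSum_mul (M : ℕ) (E : List ℤ) (f : ℤ → ℂ) (s : Finset ℕ) :
    ∑ j ∈ s, expSum M E j * f j
      = (E.map fun e => ∑ j ∈ s, zeta M ^ ((j : ℤ) * e) * f j).sum := by
  induction E with
  | nil => simp [expSum]
  | cons a E ih =>
    rw [List.map_cons, List.sum_cons, ← ih, ← Finset.sum_add_distrib]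
    refine Finset.sum_congr rfl fun j _ => ?_
    simp only [expSum, List.map_cons, List.sum_cons]
    ring

theorem mul_cast_list_sum {α : Type*} (M : ℂ) (E : List α) (f : α → ℤ) :
    M * ((E.map f).sum : ℤ) = (E.map fun e => M * (f e : ℂ)).sum := by
  induction E with
  | nil => simp
  | cons a E ih =>
    rw [List.map_cons, List.sum_cons, List.map_cons, List.sum_cons, ← ih, Int.cast_add, mul_add]

theorem sum_expSum_triple {M : ℕ} (hM : M ≠ 0) {E F G : List ℤ} (hE : ∀ e ∈ E, |2 * e| ≤ M)
    (hF : ∀ e ∈ F, |2 * e| ≤ M) (hG : ∀ e ∈ G, |2 * e| ≤ M) :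
    ∑ j ∈ Finset.range M, expSum M E j * expSum M F j * expSum M G j
      = (M : ℂ) * (tripleCount M E F G : ℂ) := by
  have h1 : ∑ j ∈ Finset.range M, expSum M E j * expSum M F j * expSum M G j
      = ∑ j ∈ Finset.range M, expSum M E (j : ℤ) * (expSum M F j * (expSum M G j * 1)) :=
    Finset.sum_congr rfl fun j _ => by ring
  rw [h1, sum_expSum_mul M E fun j => expSum M F j * (expSum M G j * 1), tripleCount,
    mul_cast_list_sum]
  refine congrArg List.sum (List.map_congr_left fun a ha => ?_)
  have h2 : ∑ j ∈ Finset.range M, zeta M ^ ((j : ℤ) * a) * (expSum M F j * (expSum M G j * 1))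
      = ∑ j ∈ Finset.range M, expSum M F j * (zeta M ^ ((j : ℤ) * a) * (expSum M G j * 1)) :=
    Finset.sum_congr rfl fun j _ => by ring
  rw [h2, sum_expSum_mul M F fun j => zeta M ^ (j * a) * (expSum M G j * 1), mul_cast_list_sum]
  refine congrArg List.sum (List.map_congr_left fun b hb => ?_)
  have h3 : ∑ j ∈ Finset.range M,
        zeta M ^ ((j : ℤ) * b) * (zeta M ^ ((j : ℤ) * a) * (expSum M G j * 1))
      = ∑ j ∈ Finset.range M, expSum M G j * (zeta M ^ ((j : ℤ) * b) * zeta M ^ ((j : ℤ) * a)) :=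
    Finset.sum_congr rfl fun j _ => by ring
  rw [h3, sum_expSum_mul M G fun j => zeta M ^ (j * b) * zeta M ^ (j * a), mul_cast_list_sum]
  refine congrArg List.sum (List.map_congr_left fun c hc => ?_)
  have hM' : (0 : ℤ) < M := by omega
  rw [← sum_zeta_zpow hM]
  · refine Finset.sum_congr rfl fun j _ => ?_
    rw [← zpow_add₀ (zeta_ne_zero M), ← zpow_add₀ (zeta_ne_zero M)]
    congr 1
    ring
  -- Three exponents of size at most M/2 have a sum of size at most 3M/2 < 2M.
  · have ha' := abs_le.1 (hE a ha)
    have hb' := abs_le.1 (hF b hb)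
    have hc' := abs_le.1 (hG c hc)
    rw [abs_lt]
    constructor <;> omega

/-- The reflection j ↦ M - j pairs the nonzero residues; for even M it fixes M/2, whence the weight
1/2 there. -/
theorem sum_orbitWeight {M s : ℕ} (hM : M ≠ 0) (hs : s = M / 2) (f : ℤ → ℂ)
    (hf : ∀ j, f (M - j) = f j) :
    ∑ k : Fin s, (orbitWeight M k : ℂ) * f (((k : ℕ) : ℤ) + 1)
      = (∑ j ∈ Finset.range M, f j - f 0) / 2 := by
  rw [Fin.sum_univ_eq_sum_range fun k : ℕ => (orbitWeight M k : ℂ) * f ((k : ℤ) + 1)]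
  rcases Nat.even_or_odd' M with ⟨a, rfl | rfl⟩
  · obtain ⟨b, rfl⟩ : ∃ b, a = b + 1 := ⟨a - 1, by omega⟩
    have hs' : s = b + 1 := by omega
    subst hs'
    rw [Finset.sum_range_succ]
    have h1 : ∀ k ∈ Finset.range b,
        (orbitWeight (2 * (b + 1)) k : ℂ) * f ((k : ℤ) + 1) = f ((k : ℤ) + 1) := by
      intro k hk
      rw [Finset.mem_range] at hk
      rw [orbitWeight, if_neg (by omega)]
      simp
    rw [Finset.sum_congr rfl h1, orbitWeight, if_pos rfl,
      show 2 * (b + 1) = b + 1 + b + 1 by ring, Finset.sum_range_succ', Finset.sum_range_add,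
      Finset.sum_range_succ, ← Finset.sum_range_reflect fun x => f ((b + 1 + x + 1 : ℕ) : ℤ)]
    have h2 : ∀ j ∈ Finset.range b, f ((b + 1 + (b - 1 - j) + 1 : ℕ) : ℤ) = f ((j : ℤ) + 1) := by
      intro j hj
      rw [Finset.mem_range] at hj
      rw [← hf ((j : ℤ) + 1)]
      congr 1
      omega
    rw [Finset.sum_congr rfl h2]
    push_cast
    ring
  · have hs' : s = a := by omega
    subst hs'
    have h1 : ∀ k ∈ Finset.range s,
        (orbitWeight (2 * s + 1) k : ℂ) * f ((k : ℤ) + 1) = f ((k : ℤ) + 1) := by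
      intro k hk
      rw [orbitWeight, if_neg (by omega)]
      simp
    rw [Finset.sum_congr rfl h1, two_mul, Finset.sum_range_succ', Finset.sum_range_add,
      ← Finset.sum_range_reflect fun x => f ((s + x + 1 : ℕ) : ℤ)]
    have h2 : ∀ j ∈ Finset.range s, f ((s + (s - 1 - j) + 1 : ℕ) : ℤ) = f ((j : ℤ) + 1) := by
      intro j hj
      rw [Finset.mem_range] at hj
      rw [← hf ((j : ℤ) + 1)]
      congr 1
      omega
    rw [Finset.sum_congr rfl h2]
    push_cast
    ring

theorem expSum_zero (M : ℕ) (E : List ℤ) : expSum M E 0 = E.length := by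
  induction E with
  | nil => simp [expSum]
  | cons a E ih => simp [expSum, add_comm]

/-- The weighted sum over orbits of a product of three even character sums. -/
theorem orbit_sum_triple {M s : ℕ} (hM : M ≠ 0) (hs : s = M / 2) {E F G : List ℤ}
    (hE : ∀ e ∈ E, |2 * e| ≤ M) (hF : ∀ e ∈ F, |2 * e| ≤ M) (hG : ∀ e ∈ G, |2 * e| ≤ M)
    (hE' : ∀ j, expSum M E (M - j) = expSum M E j) (hF' : ∀ j, expSum M F (M - j) = expSum M F j)
    (hG' : ∀ j, expSum M G (M - j) = expSum M G j) :
    ∑ k : Fin s, ((orbitWeight M k / M : ℝ) : ℂ) * (expSum M E (((k : ℕ) : ℤ) + 1)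
        * expSum M F (((k : ℕ) : ℤ) + 1) * expSum M G (((k : ℕ) : ℤ) + 1))
      = (tripleCount M E F G : ℂ) / 2 - E.length * F.length * G.length / (2 * M) := by
  -- The full sum over residues counts zero-sum triples; the removed term j = 0 is the product of
  -- the lengths.
  have h1 := sum_orbitWeight hM hs (fun j => expSum M E j * expSum M F j * expSum M G j)
    fun j => by simp only [hE', hF', hG']
  rw [sum_expSum_triple hM hE hF hG] at h1
  simp only [expSum_zero] at h1
  have hM' : (M : ℂ) ≠ 0 := Nat.cast_ne_zero.2 hM
  have h2 : ∀ k : Fin s, ((orbitWeight M k / M : ℝ) : ℂ) * (expSum M E (((k : ℕ) : ℤ) + 1)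
        * expSum M F (((k : ℕ) : ℤ) + 1) * expSum M G (((k : ℕ) : ℤ) + 1))
      = ((orbitWeight M k : ℝ) : ℂ) * (expSum M E (((k : ℕ) : ℤ) + 1)
        * expSum M F (((k : ℕ) : ℤ) + 1) * expSum M G (((k : ℕ) : ℤ) + 1)) / M := by
    intro k
    push_cast
    ring
  rw [Finset.sum_congr rfl fun k _ => h2 k, ← Finset.sum_div, h1]
  field_simp

theorem expSum_reflect_of_neg {M : ℕ} (hM : M ≠ 0) {E : List ℤ}
    (hE : ∀ j, expSum M E (-j) = expSum M E j) (j : ℤ) : expSum M E (M - j) = expSum M E j := by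
  rw [← hE j]
  simp only [expSum]
  refine congrArg List.sum (List.map_congr_left fun e _ => ?_)
  rw [sub_eq_add_neg, add_mul, zpow_add₀ (zeta_ne_zero M), zpow_mul, zpow_natCast,
    (zeta_isPrimitiveRoot hM).pow_eq_one, one_zpow, one_mul]

theorem expSum_pair_neg (M : ℕ) (e j : ℤ) : expSum M [e, -e] (-j) = expSum M [e, -e] j := by
  simp only [expSum, List.map_cons, List.map_nil, List.sum_cons, List.sum_nil,
    neg_mul, mul_neg, neg_neg, add_zero]
  rw [add_comm]

theorem zeta_two_mul {M : ℕ} (hM : M ≠ 0) : zeta (2 * M) ^ 2 = zeta M := by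
  rw [zeta, zeta, ← Complex.exp_nat_mul]
  congr 1
  have : (M : ℂ) ≠ 0 := Nat.cast_ne_zero.2 hM
  push_cast
  field_simp

theorem zeta_two_mul_pow {M : ℕ} (hM : M ≠ 0) : zeta (2 * M) ^ M = -1 := by
  rw [zeta, ← Complex.exp_nat_mul, ← Complex.exp_pi_mul_I]
  congr 1
  have : (M : ℂ) ≠ 0 := Nat.cast_ne_zero.2 hM
  push_cast
  field_simp

end InterpolatedPSL2

/-! ### Rows, columns and multiplicities of the generic table -/

namespace InterpolatedPSL2

deriving instance DecidableEq for Row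

variable {h m p u s n : ℕ}

/-- The rows of a generic character table as a disjoint union of index sets. -/
def rowEquiv : Row h m p ≃ Unit ⊕ Fin h ⊕ Fin m ⊕ Unit ⊕ Fin p where
  toFun
    | .triv => .inl ()
    | .half c => .inr (.inl c)
    | .minus c => .inr (.inr (.inl c))
    | .steinberg => .inr (.inr (.inr (.inl ())))
    | .plus c => .inr (.inr (.inr (.inr c)))
  invFun
    | .inl _ => .triv
    | .inr (.inl c) => .half c
    | .inr (.inr (.inl c)) => .minus c
    | .inr (.inr (.inr (.inl _))) => .steinberg
    | .inr (.inr (.inr (.inr c))) => .plus c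
  left_inv x := by cases x <;> rfl
  right_inv x := by rcases x with _ | _ | _ | _ | _ <;> rfl

instance : Fintype (Row h m p) := Fintype.ofEquiv _ rowEquiv.symm

/-- The columns of a generic character table as a disjoint union of index sets. -/
def colEquiv : Col u s n ≃ Unit ⊕ Fin u ⊕ Fin s ⊕ Fin n where
  toFun
    | .triv => .inl ()
    | .unipotent k => .inr (.inl k)
    | .split k => .inr (.inr (.inl k))
    | .nonsplit k => .inr (.inr (.inr k))
  invFun
    | .inl _ => .triv
    | .inr (.inl k) => .unipotent k
    | .inr (.inr (.inl k)) => .split k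
    | .inr (.inr (.inr k)) => .nonsplit k
  left_inv x := by cases x <;> rfl
  right_inv x := by rcases x with _ | _ | _ | _ <;> rfl

theorem card_row : Fintype.card (Row h m p) = h + m + p + 2 := by
  rw [Fintype.card_congr rowEquiv]
  simp
  ring

theorem card_col : Fintype.card (Col u s n) = u + s + n + 1 := by
  rw [Fintype.card_congr colEquiv]
  simp
  ring

theorem sum_col {A : Type*} [AddCommMonoid A] (f : Col u s n → A) :
    ∑ x, f x = f .triv + (∑ k, f (.unipotent k) + (∑ k, f (.split k) + ∑ k, f (.nonsplit k))) := by
  rw [← Equiv.sum_comp colEquiv.symm]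
  simp [Fintype.sum_sum_type, colEquiv]

/-- The exponents of the restriction of a row to the split classes; `hs` are those of the rows of
half degree. -/
def splitExp (hs : List ℤ) : Row h m p → List ℤ
  | .triv => [0]
  | .half _ => hs
  | .minus _ => []
  | .steinberg => [0]
  | .plus c => [(c : ℤ) + 1, -((c : ℤ) + 1)]

/-- The exponents of the restriction of a row to the nonsplit classes; `hn` are those of the rows of
half degree. -/
def nonsplitExp (hn : List ℤ) : Row h m p → List ℤ
  | .triv => [0]
  | .half _ => hn
  | .minus c => [(c : ℤ) + 1, -((c : ℤ) + 1)]
  | .steinberg => [0]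
  | .plus _ => []

/-- The sign of the restriction of a row to the nonsplit classes. -/
def nonsplitSign : Row h m p → ℤ
  | .triv => 1
  | .half _ => -1
  | .minus _ => -1
  | .steinberg => -1
  | .plus _ => 1

/-- The value of `excess` on two rows of half degree and another row. -/
def pairExcess (σ : ℤ) : Row h m p → ℤ
  | .triv => 2 * σ - 1
  | .half _ => 0
  | .minus _ => 2 - 2 * σ
  | .steinberg => 1
  | .plus _ => 2 * σ

/-- The part of twice a triple multiplicity that does not come from coincidences of exponents. -/
def excess (c₀ : ℤ) (σ : Fin h → Fin h → ℤ) : Row h m p → Row h m p → Row h m p → ℤ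
  | .half a, .half b, .half c => if a = b ∧ b = c then 2 else 0
  | .half a, .half b, x => pairExcess (σ a b) x
  | .half a, x, .half b => pairExcess (σ a b) x
  | x, .half a, .half b => pairExcess (σ a b) x
  | .triv, _, _ => 0
  | _, .triv, _ => 0
  | _, _, .triv => 0
  | .half _, _, _ => 2
  | _, .half _, _ => 2
  | _, _, .half _ => 2
  | _, _, _ => c₀

/-- Twice a triple multiplicity. -/
def doubleMult (Ms Mn : ℕ) (hs hn : List ℤ) (c₀ : ℤ) (σ : Fin h → Fin h → ℤ)
    (i j k : Row h m p) : ℤ :=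
  excess c₀ σ i j k + tripleCount Ms (splitExp hs i) (splitExp hs j) (splitExp hs k)
    + nonsplitSign i * nonsplitSign j * nonsplitSign k
      * tripleCount Mn (nonsplitExp hn i) (nonsplitExp hn j) (nonsplitExp hn k)

/-- A triple multiplicity. -/
def mult (Ms Mn : ℕ) (hs hn : List ℤ) (c₀ : ℤ) (σ : Fin h → Fin h → ℤ)
    (i j k : Row h m p) : ℕ :=
  -- Halving and truncation lose nothing, by `doubleMult_even_nonneg`.
  (doubleMult Ms Mn hs hn c₀ σ i j k / 2).toNat

/-- The column weights: the proportion of the group taken up by a conjugacy class. -/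
noncomputable def colWeight (q Ms Mn : ℕ) (w₀ : ℝ) : Col u s n → ℝ
  | .triv => w₀
  | .unipotent _ => 1 / q
  | .split k => orbitWeight Ms k / Ms
  | .nonsplit k => orbitWeight Mn k / Mn

section General

variable {q Ms Mn : ℕ} {hs hn : List ℤ} {c₀ : ℤ} {σ : Fin h → Fin h → ℤ} {w₀ : ℝ}
  {T : Row h m p → Col u s n → ℂ}

theorem splitExp_bound (hp : 2 * p ≤ Ms) (hhs : ∀ e ∈ hs, |2 * e| ≤ Ms) (i : Row h m p) :
    ∀ e ∈ splitExp hs i, |2 * e| ≤ Ms := by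
  cases i with
  | half c => exact hhs
  | plus c =>
    intro e he
    have := c.isLt
    simp only [splitExp, List.mem_cons, List.not_mem_nil, or_false] at he
    rw [abs_le]
    omega
  | _ => simp [splitExp]

theorem nonsplitExp_bound (hm : 2 * m ≤ Mn) (hhn : ∀ e ∈ hn, |2 * e| ≤ Mn) (i : Row h m p) :
    ∀ e ∈ nonsplitExp hn i, |2 * e| ≤ Mn := by
  cases i with
  | half c => exact hhn
  | minus c =>
    intro e he
    have := c.isLt
    simp only [nonsplitExp, List.mem_cons, List.not_mem_nil, or_false] at he
    rw [abs_le]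
    omega
  | _ => simp [nonsplitExp]

theorem splitExp_reflect (hMs : Ms ≠ 0) (hhs : ∀ j, expSum Ms hs (-j) = expSum Ms hs j)
    (i : Row h m p) (j : ℤ) : expSum Ms (splitExp hs i) (Ms - j) = expSum Ms (splitExp hs i) j := by
  refine expSum_reflect_of_neg hMs (fun j => ?_) j
  cases i with
  | half c => exact hhs j
  | plus c => exact expSum_pair_neg Ms _ j
  | _ => simp [splitExp, expSum]

theorem nonsplitExp_reflect (hMn : Mn ≠ 0) (hhn : ∀ j, expSum Mn hn (-j) = expSum Mn hn j)
    (i : Row h m p) (j : ℤ) :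
    expSum Mn (nonsplitExp hn i) (Mn - j) = expSum Mn (nonsplitExp hn i) j := by
  refine expSum_reflect_of_neg hMn (fun j => ?_) j
  cases i with
  | half c => exact hhn j
  | minus c => exact expSum_pair_neg Mn _ j
  | _ => simp [nonsplitExp, expSum]

/-- The weighted triple sums of the rows of a table of the generic shape. -/
theorem sum_triple_eq (hMs : Ms ≠ 0) (hMn : Mn ≠ 0) (hs' : s = Ms / 2) (hn' : n = Mn / 2)
    (hp : 2 * p ≤ Ms) (hm : 2 * m ≤ Mn)
    (hhs : ∀ e ∈ hs, |2 * e| ≤ Ms) (hhn : ∀ e ∈ hn, |2 * e| ≤ Mn)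
    (hrs : ∀ j, expSum Ms hs (-j) = expSum Ms hs j) (hrn : ∀ j, expSum Mn hn (-j) = expSum Mn hn j)
    (hTs : ∀ i k, T i (.split k) = expSum Ms (splitExp hs i) (((k : ℕ) : ℤ) + 1))
    (hTn : ∀ i k, T i (.nonsplit k)
      = nonsplitSign i * expSum Mn (nonsplitExp hn i) (((k : ℕ) : ℤ) + 1))
    (hK : ∀ i j k : Row h m p, (w₀ : ℂ) * (T i .triv * T j .triv * T k .triv)
      + ∑ x, 1 / (q : ℂ) * (T i (.unipotent x) * T j (.unipotent x) * T k (.unipotent x))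
      = excess c₀ σ i j k / 2
        + (splitExp hs i).length * (splitExp hs j).length * (splitExp hs k).length / (2 * Ms)
        + nonsplitSign i * nonsplitSign j * nonsplitSign k
          * ((nonsplitExp hn i).length * (nonsplitExp hn j).length * (nonsplitExp hn k).length
            / (2 * Mn)))
    (i j k : Row h m p) :
    ∑ x, (colWeight q Ms Mn w₀ x : ℂ) * (T i x * T j x * T k x)
      = doubleMult Ms Mn hs hn c₀ σ i j k / 2 := by
  have h1 := orbit_sum_triple hMs hs' (splitExp_bound hp hhs i) (splitExp_bound hp hhs j)
    (splitExp_bound hp hhs k) (splitExp_reflect hMs hrs i) (splitExp_reflect hMs hrs j)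
    (splitExp_reflect hMs hrs k)
  have h2 := orbit_sum_triple hMn hn' (nonsplitExp_bound hm hhn i) (nonsplitExp_bound hm hhn j)
    (nonsplitExp_bound hm hhn k) (nonsplitExp_reflect hMn hrn i) (nonsplitExp_reflect hMn hrn j)
    (nonsplitExp_reflect hMn hrn k)
  have h3 : ∑ x, (colWeight q Ms Mn w₀ (Col.nonsplit x : Col u s n) : ℂ)
      * (T i (.nonsplit x) * T j (.nonsplit x) * T k (.nonsplit x))
      = nonsplitSign i * nonsplitSign j * nonsplitSign k
        * ((tripleCount Mn (nonsplitExp hn i) (nonsplitExp hn j) (nonsplitExp hn k) : ℂ) / 2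
          - (nonsplitExp hn i).length * (nonsplitExp hn j).length * (nonsplitExp hn k).length
            / (2 * Mn)) := by
    rw [← h2, Finset.mul_sum]
    refine Finset.sum_congr rfl fun x _ => ?_
    simp only [hTn, colWeight]
    ring
  have h4 : ∑ x, (colWeight q Ms Mn w₀ (Col.split x : Col u s n) : ℂ)
      * (T i (.split x) * T j (.split x) * T k (.split x))
      = (tripleCount Ms (splitExp hs i) (splitExp hs j) (splitExp hs k) : ℂ) / 2
        - (splitExp hs i).length * (splitExp hs j).length * (splitExp hs k).length
          / (2 * Ms) := by
    rw [← h1]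
    refine Finset.sum_congr rfl fun x _ => ?_
    simp only [hTs, colWeight]
  have h5 := hK i j k
  rw [sum_col, h3, h4, ← add_assoc]
  simp only [colWeight, Complex.ofReal_div, Complex.ofReal_one, Complex.ofReal_natCast]
  rw [h5, doubleMult]
  push_cast
  ring

end General

end InterpolatedPSL2

/-! ### Integrality and nonnegativity of the multiplicities -/

namespace InterpolatedPSL2

variable {h m p u s n : ℕ}

/-- An ordering of the families of rows. -/
def rank : Row h m p → ℕ
  | .triv => 0
  | .half _ => 1
  | .minus _ => 2
  | .steinberg => 3
  | .plus _ => 4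

/-- Symmetry leaves 35 of the 125 combinations of families to check. -/
theorem sorted_induction {P : Row h m p → Row h m p → Row h m p → Prop}
    (h₁ : ∀ i j k, P i j k → P j i k) (h₂ : ∀ i j k, P i j k → P i k j)
    (hP : ∀ i j k, rank i ≤ rank j → rank j ≤ rank k → P i j k) (i j k : Row h m p) :
    P i j k := by
  rcases le_total (rank i) (rank j) with h3 | h3 <;>
  rcases le_total (rank j) (rank k) with h4 | h4 <;>
  rcases le_total (rank i) (rank k) with h5 | h5
  · exact hP _ _ _ h3 h4
  · exact hP _ _ _ h3 h4
  · exact h₂ _ _ _ (hP _ _ _ h5 h4)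
  · exact h₂ _ _ _ (h₁ _ _ _ (hP _ _ _ h5 h3))
  · exact h₁ _ _ _ (hP _ _ _ h3 h5)
  · exact h₁ _ _ _ (h₂ _ _ _ (hP _ _ _ h4 h5))
  · exact h₁ _ _ _ (h₂ _ _ _ (h₁ _ _ _ (hP _ _ _ h4 h3)))
  · exact h₁ _ _ _ (h₂ _ _ _ (h₁ _ _ _ (hP _ _ _ h4 h3)))

theorem excess_swap_left {c₀ : ℤ} {σ : Fin h → Fin h → ℤ} (hσ : ∀ a b, σ a b = σ b a)
    (i j k : Row h m p) : excess c₀ σ i j k = excess c₀ σ j i k := by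
  cases i <;> cases j <;> cases k <;> simp only [excess] <;> first
    | (rw [hσ])
    | (congr 1; simp only [eq_iff_iff]; grind)

theorem excess_swap_right {c₀ : ℤ} {σ : Fin h → Fin h → ℤ} (hσ : ∀ a b, σ a b = σ b a)
    (i j k : Row h m p) : excess c₀ σ i j k = excess c₀ σ i k j := by
  cases i <;> cases j <;> cases k <;> simp only [excess] <;> first
    | (rw [hσ])
    | (congr 1; simp only [eq_iff_iff]; grind)

theorem wrap_neg (M e : ℤ) : wrap M (-e) = wrap M e := by
  unfold wrap
  congr 1
  simp only [eq_iff_iff]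
  omega

/-- The eight sign patterns form four opposite pairs, which makes the count visibly even. -/
theorem tripleCount_pairs (M a b c : ℤ) :
    tripleCount M [a, -a] [b, -b] [c, -c]
      = 2 * (wrap M (a + b + c) + wrap M (a + b - c) + wrap M (a - b + c) + wrap M (a - b - c)) := by
  simp only [tripleCount, List.map_cons, List.map_nil, List.sum_cons, List.sum_nil]
  rw [← wrap_neg M (-a + b + c), ← wrap_neg M (-a + b + -c), ← wrap_neg M (-a + -b + c),
    ← wrap_neg M (-a + -b + -c)]
  ring_nf

-- Each combination of families is linear arithmetic in the exponents. Where the nonsplit count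
-- enters negatively, the excess or the split count compensates it. By `hh`, the half-degree rows
-- vanish on one torus and are, up to sign, the quadratic character of the other.
set_option maxHeartbeats 2000000 in
theorem doubleMult_even_nonneg {Ms Mn L : ℕ} {hs hn : List ℤ} {c₀ : ℤ} {σ : Fin h → Fin h → ℤ}
    (hc : 2 ≤ c₀) (hc' : c₀ % 2 = 0) (hp : 2 * p < Ms) (hm : 2 * m < Mn)
    (hσ : ∀ a b, σ a b = 0 ∨ σ a b = 1)
    (hh : Fin h → (hs = [] ∧ hn = [(L : ℤ)] ∧ Mn = 2 * L) ∨
      (hs = [(L : ℤ)] ∧ hn = [] ∧ Ms = 2 * L))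
    (i j k : Row h m p) (hij : rank i ≤ rank j) (hjk : rank j ≤ rank k) :
    0 ≤ doubleMult Ms Mn hs hn c₀ σ i j k ∧ doubleMult Ms Mn hs hn c₀ σ i j k % 2 = 0 := by
  rcases i with _ | a | a | _ | a <;> rcases j with _ | b | b | _ | b <;>
    rcases k with _ | c | c | _ | c <;>
    first
    | (exfalso; simp [rank] at hij hjk; done)
    | (have hM := hh a; rcases hM with ⟨rfl, rfl, hM⟩ | ⟨rfl, rfl, hM⟩)
    | (have hM := hh b; rcases hM with ⟨rfl, rfl, hM⟩ | ⟨rfl, rfl, hM⟩)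
    | (have hM := hh c; rcases hM with ⟨rfl, rfl, hM⟩ | ⟨rfl, rfl, hM⟩)
    | skip
  all_goals
    simp only [doubleMult, excess, pairExcess, splitExp, nonsplitExp, nonsplitSign,
      tripleCount_pairs]
    simp only [tripleCount, List.map_cons, List.map_nil, List.sum_cons, List.sum_nil, wrap]
    clear hij hjk
    try have hab := hσ a b
    try have hbc := hσ b c
    try have ha := a.isLt
    try have hb := b.isLt
    try have hcc := c.isLt
    clear hσ hh
    try split_ifs
  all_goals omega

end InterpolatedPSL2

/-! ### Tables of the generic shape are fusion tables -/

namespace InterpolatedPSL2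

variable {h m p u s n : ℕ}

/-- The duality of rows that acts by `τ` on the rows of half degree. -/
def dualRow (τ : Fin h → Fin h) : Row h m p → Row h m p
  | .half c => .half (τ c)
  | x => x

/-- The indicator of dual pairs of rows of half degree. -/
def dualIndicator (τ : Fin h → Fin h) (a b : Fin h) : ℤ := if b = τ a then 1 else 0

theorem dualIndicator_symm {τ : Fin h → Fin h} (hτ : ∀ a, τ (τ a) = a) (a b : Fin h) :
    dualIndicator τ a b = dualIndicator τ b a := by
  unfold dualIndicator
  congr 1
  simp only [eq_iff_iff]
  grind

theorem dualIndicator_cases (τ : Fin h → Fin h) (a b : Fin h) :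
    dualIndicator τ a b = 0 ∨ dualIndicator τ a b = 1 := by
  unfold dualIndicator
  split_ifs <;> simp

theorem dualRow_dualRow {τ : Fin h → Fin h} (hτ : ∀ a, τ (τ a) = a) (i : Row h m p) :
    dualRow τ (dualRow τ i) = i := by
  cases i <;> simp [dualRow, hτ]

theorem doubleMult_triv {Ms Mn L : ℕ} {hs hn : List ℤ} {c₀ : ℤ} {τ : Fin h → Fin h}
    (hp : 2 * p < Ms) (hm : 2 * m < Mn)
    (hh : Fin h → (hs = [] ∧ hn = [(L : ℤ)] ∧ Mn = 2 * L) ∨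
      (hs = [(L : ℤ)] ∧ hn = [] ∧ Ms = 2 * L)) (i j : Row h m p) :
    doubleMult Ms Mn hs hn c₀ (dualIndicator τ) .triv i j
      = if j = dualRow τ i then 2 else 0 := by
  rcases i with _ | b | b | _ | b <;> rcases j with _ | c | c | _ | c <;>
    first
    | (have hM := hh b; rcases hM with ⟨rfl, rfl, hM⟩ | ⟨rfl, rfl, hM⟩)
    | (have hM := hh c; rcases hM with ⟨rfl, rfl, hM⟩ | ⟨rfl, rfl, hM⟩)
    | skip
  all_goals
    simp only [doubleMult, excess, pairExcess, splitExp, nonsplitExp, nonsplitSign, dualRow,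
      Row.half.injEq, Row.minus.injEq, Row.plus.injEq, reduceCtorEq, dualIndicator]
    simp only [tripleCount, List.map_cons, List.map_nil, List.sum_cons, List.sum_nil, wrap]
    try have hb := b.isLt
    try have hcc := c.isLt
    try simp only [Fin.ext_iff]
    try split_ifs
  all_goals first | contradiction | omega

theorem sum_unipotent_identity_of_sorted {q Ms Mn : ℕ} {hs hn : List ℤ} {c₀ : ℤ}
    {σ : Fin h → Fin h → ℤ} {w₀ : ℝ} {T : Row h m p → Col u s n → ℂ} (hσ : ∀ a b, σ a b = σ b a)
    (hK : ∀ i j k : Row h m p, rank i ≤ rank j → rank j ≤ rank k →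
      (w₀ : ℂ) * (T i .triv * T j .triv * T k .triv)
      + ∑ x, 1 / (q : ℂ) * (T i (.unipotent x) * T j (.unipotent x) * T k (.unipotent x))
      = excess c₀ σ i j k / 2
        + (splitExp hs i).length * (splitExp hs j).length * (splitExp hs k).length / (2 * Ms)
        + nonsplitSign i * nonsplitSign j * nonsplitSign k
          * ((nonsplitExp hn i).length * (nonsplitExp hn j).length * (nonsplitExp hn k).length
            / (2 * Mn))) (i j k : Row h m p) :
    (w₀ : ℂ) * (T i .triv * T j .triv * T k .triv)
      + ∑ x, 1 / (q : ℂ) * (T i (.unipotent x) * T j (.unipotent x) * T k (.unipotent x))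
      = excess c₀ σ i j k / 2
        + (splitExp hs i).length * (splitExp hs j).length * (splitExp hs k).length / (2 * Ms)
        + nonsplitSign i * nonsplitSign j * nonsplitSign k
          * ((nonsplitExp hn i).length * (nonsplitExp hn j).length * (nonsplitExp hn k).length
            / (2 * Mn)) := by
  refine sorted_induction (fun i j k h0 => ?_) (fun i j k h0 => ?_) hK i j k
  · rw [excess_swap_left hσ j i k, Finset.sum_congr rfl fun x _ =>
      show _ = 1 / (q : ℂ) * (T i (.unipotent x) * T j (.unipotent x) * T k (.unipotent x)) by ring]
    linear_combination h0
  · rw [excess_swap_right hσ i k j, Finset.sum_congr rfl fun x _ =>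
      show _ = 1 / (q : ℂ) * (T i (.unipotent x) * T j (.unipotent x) * T k (.unipotent x)) by ring]
    linear_combination h0

/-- A table of the generic shape is a fusion table. -/
theorem isFusionTable_of_shape {q Ms Mn L : ℕ} {hs hn : List ℤ} {c₀ : ℤ} {τ : Fin h → Fin h}
    {w₀ : ℝ} {T : Row h m p → Col u s n → ℂ} (hτ : ∀ a, τ (τ a) = a)
    (hs' : s = Ms / 2) (hn' : n = Mn / 2) (hcard : h + m + p + 1 = u + s + n)
    (hp : 2 * p < Ms) (hm : 2 * m < Mn) (hc : 2 ≤ c₀) (hc' : c₀ % 2 = 0)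
    (hhs : ∀ e ∈ hs, |2 * e| ≤ Ms) (hhn : ∀ e ∈ hn, |2 * e| ≤ Mn)
    (hrs : ∀ j, expSum Ms hs (-j) = expSum Ms hs j) (hrn : ∀ j, expSum Mn hn (-j) = expSum Mn hn j)
    (hh : Fin h → (hs = [] ∧ hn = [(L : ℤ)] ∧ Mn = 2 * L) ∨
      (hs = [(L : ℤ)] ∧ hn = [] ∧ Ms = 2 * L))
    (hT : ∀ x, T .triv x = 1) (hT' : ∀ i x, star (T i x) = T (dualRow τ i) x)
    (hTs : ∀ i k, T i (.split k) = expSum Ms (splitExp hs i) (((k : ℕ) : ℤ) + 1))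
    (hTn : ∀ i k, T i (.nonsplit k)
      = nonsplitSign i * expSum Mn (nonsplitExp hn i) (((k : ℕ) : ℤ) + 1))
    (hK : ∀ i j k : Row h m p, rank i ≤ rank j → rank j ≤ rank k →
      (w₀ : ℂ) * (T i .triv * T j .triv * T k .triv)
      + ∑ x, 1 / (q : ℂ) * (T i (.unipotent x) * T j (.unipotent x) * T k (.unipotent x))
      = excess c₀ (dualIndicator τ) i j k / 2
        + (splitExp hs i).length * (splitExp hs j).length * (splitExp hs k).length / (2 * Ms)
        + nonsplitSign i * nonsplitSign j * nonsplitSign k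
          * ((nonsplitExp hn i).length * (nonsplitExp hn j).length * (nonsplitExp hn k).length
            / (2 * Mn))) :
    FusionRing.IsFusionTable T (colWeight q Ms Mn w₀) .triv (dualRow τ)
        (mult Ms Mn hs hn c₀ (dualIndicator τ)) ∧
      ∀ i j k : Row h m p, 2 * (mult Ms Mn hs hn c₀ (dualIndicator τ) i j k : ℤ)
        = doubleMult Ms Mn hs hn c₀ (dualIndicator τ) i j k := by
  have hsum := sum_triple_eq (by omega) (by omega) hs' hn' hp.le hm.le hhs hhn hrs hrn hTs hTn
    (sum_unipotent_identity_of_sorted (dualIndicator_symm hτ) hK)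
  -- The symmetry is read off from the sum over columns, where it is evident.
  have hl : ∀ i j k : Row h m p, doubleMult Ms Mn hs hn c₀ (dualIndicator τ) i j k
      = doubleMult Ms Mn hs hn c₀ (dualIndicator τ) j i k := by
    intro i j k
    have h1 := hsum i j k
    rw [Finset.sum_congr rfl fun x _ => show _ = (colWeight q Ms Mn w₀ x : ℂ)
      * (T j x * T i x * T k x) by ring, hsum j i k, div_left_inj' two_ne_zero] at h1
    exact_mod_cast h1.symm
  have hr : ∀ i j k : Row h m p, doubleMult Ms Mn hs hn c₀ (dualIndicator τ) i j k
      = doubleMult Ms Mn hs hn c₀ (dualIndicator τ) i k j := by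
    intro i j k
    have h1 := hsum i j k
    rw [Finset.sum_congr rfl fun x _ => show _ = (colWeight q Ms Mn w₀ x : ℂ)
      * (T i x * T k x * T j x) by ring, hsum i k j, div_left_inj' two_ne_zero] at h1
    exact_mod_cast h1.symm
  have hmult : ∀ i j k : Row h m p, 2 * (mult Ms Mn hs hn c₀ (dualIndicator τ) i j k : ℤ)
      = doubleMult Ms Mn hs hn c₀ (dualIndicator τ) i j k := by
    intro i j k
    have h1 := sorted_induction
      (P := fun i j k : Row h m p => 0 ≤ doubleMult Ms Mn hs hn c₀ (dualIndicator τ) i j k ∧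
        doubleMult Ms Mn hs hn c₀ (dualIndicator τ) i j k % 2 = 0)
      (fun i j k h0 => by rwa [hl j i k]) (fun i j k h0 => by rwa [hr i k j])
      (doubleMult_even_nonneg hc hc' hp hm (dualIndicator_cases τ) hh) i j k
    rw [mult]
    omega
  refine ⟨⟨?_, hT, hT', dualRow_dualRow hτ, fun i j k => ?_, fun i j => ?_⟩, hmult⟩
  · rw [card_row, card_col]
    omega
  · rw [hsum, ← hmult]
    push_cast
    ring
  · have h1 := hmult .triv i j
    rw [doubleMult_triv hp hm hh] at h1
    split_ifs at h1 ⊢ <;> omega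

theorem star_zeta_zpow (M : ℕ) (a : ℤ) : star (zeta M ^ a) = zeta M ^ (-a) := by
  have h1 : star (zeta M) = (zeta M)⁻¹ := by
    rw [zeta, ← Complex.exp_neg]
    change (starRingEnd ℂ) _ = _
    rw [← Complex.exp_conj]
    congr 1
    simp [neg_div, map_ofNat (starRingEnd ℂ) 2]
  rw [star_zpow₀, h1, inv_zpow, zpow_neg]

theorem star_zetaSum (M a : ℕ) : star (zetaSum M a) = zetaSum M a := by
  rw [zetaSum, star_add, star_zeta_zpow, star_zeta_zpow, neg_neg, add_comm]

theorem expSum_pair (M : ℕ) (a b : ℕ) :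
    expSum M [(a : ℤ) + 1, -((a : ℤ) + 1)] ((b : ℤ) + 1) = zetaSum M ((b + 1) * (a + 1)) := by
  simp only [expSum, zetaSum, List.map_cons, List.map_nil, List.sum_cons, List.sum_nil, add_zero,
    mul_neg]
  push_cast
  rfl

/-- For odd q the tables use even powers of ζ_{q±1}, whereas the cyclic groups have order (q ± 1)/2.
-/
theorem zetaSum_two_mul {M : ℕ} (hM : M ≠ 0) (a b : ℕ) :
    zetaSum (2 * M) (2 * a * b) = zetaSum M (a * b) := by
  have : ∀ e : ℤ, zeta (2 * M) ^ (2 * e) = zeta M ^ e := by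
    intro e
    rw [zpow_mul, ← zeta_two_mul hM]
    rfl
  simp only [zetaSum]
  rw [← this, ← this]
  push_cast
  congr 2 <;> ring

end InterpolatedPSL2

/-! ### The three families of tables -/

namespace InterpolatedPSL2

theorem neg_one_pow_expSum {L : ℕ} (hL : L ≠ 0) (k : ℕ) :
    expSum (2 * L) [(L : ℤ)] ((k : ℤ) + 1) = (-1) ^ (k + 1) := by
  simp only [expSum, List.map_cons, List.map_nil, List.sum_cons, List.sum_nil, add_zero]
  rw [mul_comm _ (L : ℤ), zpow_mul, zpow_natCast, zeta_two_mul_pow hL]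
  exact zpow_natCast _ (k + 1)

theorem expSum_half_neg {L : ℕ} (hL : L ≠ 0) (j : ℤ) :
    expSum (2 * L) [(L : ℤ)] (-j) = expSum (2 * L) [(L : ℤ)] j := by
  simp only [expSum, List.map_cons, List.map_nil, List.sum_cons, List.sum_nil, add_zero]
  rw [mul_comm _ (L : ℤ), zpow_mul, zpow_natCast, zeta_two_mul_pow hL, mul_comm _ (L : ℤ), zpow_mul,
    zpow_natCast, zeta_two_mul_pow hL, zpow_neg, ← inv_zpow, inv_neg, inv_one]

theorem tableEven_isFusionTable {q : ℕ} (hq : 2 ≤ q) (hq2 : q % 2 = 0) :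
    FusionRing.IsFusionTable (tableEven q)
        (colWeight q (q - 1) (q + 1) (1 / (q * (q - 1) * (q + 1)))) .triv (dualRow id)
        (mult (q - 1) (q + 1) [] [] 2 (dualIndicator id)) ∧
      ∀ i j k : Row 0 (q / 2) ((q - 2) / 2),
        2 * (mult (q - 1) (q + 1) [] [] 2 (dualIndicator id) i j k : ℤ)
          = doubleMult (q - 1) (q + 1) [] [] 2 (dualIndicator id) i j k := by
  refine isFusionTable_of_shape (L := 0) (fun _ => rfl) (by omega) (by omega) (by omega) (by omega)
    (by omega) le_rfl rfl (by simp) (by simp) (fun j => rfl) (fun j => rfl) (fun a => a.elim0)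
    (fun x => by cases x <;> rfl) ?_ ?_ ?_ ?_
  · intro i x
    rcases i with _ | a | a | _ | a <;> rcases x with _ | b | b | b <;>
      first
      | exact a.elim0
      | simp [tableEven, dualRow, star_zetaSum]
  · intro i k
    cases i with
    | half c => exact c.elim0
    | plus c => exact (expSum_pair _ _ _).symm
    | _ => simp [tableEven, splitExp, expSum]
  · intro i k
    cases i with
    | half c => exact c.elim0
    | minus c =>
      rw [nonsplitExp, expSum_pair, nonsplitSign, Int.cast_neg, Int.cast_one, neg_one_mul]
      rfl
    | _ => simp [tableEven, nonsplitExp, expSum, nonsplitSign]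
  · intro i j k hij hjk
    have h1 : ((q - 1 : ℕ) : ℂ) = (q : ℂ) - 1 := by
      rw [Nat.cast_sub (by omega), Nat.cast_one]
    have h2 : (q : ℂ) - 1 ≠ 0 := by
      rw [← h1]
      exact Nat.cast_ne_zero.2 (by omega)
    have h3 : (q : ℂ) + 1 ≠ 0 := by
      exact_mod_cast Nat.succ_ne_zero q
    have h4 : (q : ℂ) ≠ 0 := Nat.cast_ne_zero.2 (by omega)
    rcases i with _ | a | a | _ | a <;> rcases j with _ | b | b | _ | b <;>
      rcases k with _ | c | c | _ | c <;>
      first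
      | exact a.elim0
      | exact b.elim0
      | exact c.elim0
      | (exfalso; simp [rank] at hij hjk; done)
      | skip
    all_goals
      simp only [tableEven, excess, splitExp, nonsplitExp, nonsplitSign, List.length_cons,
        List.length_nil, Fintype.sum_unique]
      push_cast
      rw [h1]
      field_simp
      try ring

end InterpolatedPSL2

namespace InterpolatedPSL2

set_option maxHeartbeats 2000000 in
theorem tableOneModFour_isFusionTable {q : ℕ} (hq : 2 ≤ q) (hq4 : q % 4 = 1) :
    FusionRing.IsFusionTable (tableOneModFour q)
        (colWeight q ((q - 1) / 2) ((q + 1) / 2) (2 / (q * (q - 1) * (q + 1)))) .triv (dualRow id)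
        (mult ((q - 1) / 2) ((q + 1) / 2) [((q - 1) / 4 : ℕ)] [] 4 (dualIndicator id)) ∧
      ∀ i j k : Row 2 ((q - 1) / 4) ((q - 5) / 4),
        2 * (mult ((q - 1) / 2) ((q + 1) / 2) [((q - 1) / 4 : ℕ)] [] 4 (dualIndicator id) i j k : ℤ)
          = doubleMult ((q - 1) / 2) ((q + 1) / 2) [((q - 1) / 4 : ℕ)] [] 4 (dualIndicator id)
            i j k := by
  have hL : (q - 1) / 2 = 2 * ((q - 1) / 4) := by omega
  have hL0 : (q - 1) / 4 ≠ 0 := by omega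
  have hqs : q - 1 = 2 * ((q - 1) / 2) := by omega
  have hqn : q + 1 = 2 * ((q + 1) / 2) := by omega
  refine isFusionTable_of_shape (L := (q - 1) / 4) (fun _ => rfl) (by omega) (by omega) (by omega)
    (by omega) (by omega) (by norm_num) rfl ?_ (by simp) ?_ (fun j => rfl)
    (fun a => Or.inr ⟨rfl, rfl, hL⟩) (fun x => by cases x <;> rfl) ?_ ?_ ?_ ?_
  · intro e he
    rw [List.mem_singleton] at he
    rw [abs_le]
    omega
  · rw [hL]
    exact expSum_half_neg hL0
  · intro i x
    rcases i with _ | a | a | _ | a <;> rcases x with _ | b | b | b <;>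
      simp [tableOneModFour, dualRow, star_zetaSum]
  · intro i k
    cases i with
    | half c =>
      rw [splitExp, hL, neg_one_pow_expSum hL0]
      rfl
    | plus c =>
      rw [splitExp, expSum_pair, ← zetaSum_two_mul (by omega), ← hqs]
      rfl
    | _ => simp [tableOneModFour, splitExp, expSum]
  · intro i k
    cases i with
    | minus c =>
      rw [nonsplitExp, expSum_pair, nonsplitSign, Int.cast_neg, Int.cast_one, neg_one_mul,
        ← zetaSum_two_mul (by omega), ← hqn]
      rfl
    | _ => simp [tableOneModFour, nonsplitExp, expSum, nonsplitSign]
  · intro i j k hij hjk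
    have h1 : (((q - 1) / 2 : ℕ) : ℂ) = ((q : ℂ) - 1) / 2 := by
      have := congrArg (Nat.cast : ℕ → ℂ) (show q = 2 * ((q - 1) / 2) + 1 by omega)
      push_cast at this
      linear_combination - this / 2
    have h1' : (((q + 1) / 2 : ℕ) : ℂ) = ((q : ℂ) + 1) / 2 := by
      have := congrArg (Nat.cast : ℕ → ℂ) hqn
      push_cast at this
      linear_combination - this / 2
    have h2 : (q : ℂ) - 1 ≠ 0 := by
      intro h0
      rw [h0] at h1
      have : (q - 1) / 2 = 0 := by exact_mod_cast h1.trans (zero_div _)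
      omega
    have h3 : (q : ℂ) + 1 ≠ 0 := by
      exact_mod_cast Nat.succ_ne_zero q
    have h4 : (q : ℂ) ≠ 0 := Nat.cast_ne_zero.2 (by omega)
    -- In terms of r = √q the required identity is one of rational functions.
    obtain ⟨r, hr', hr⟩ : ∃ r : ℂ, (Real.sqrt q : ℂ) = r ∧ (q : ℂ) = r ^ 2 := by
      refine ⟨_, rfl, ?_⟩
      exact_mod_cast (Real.sq_sqrt (Nat.cast_nonneg q)).symm
    have hr0 : r ≠ 0 := by
      rintro rfl
      simp at hr
      omega
    rcases i with _ | a₀ | a | _ | a <;> rcases j with _ | b₀ | b | _ | b <;>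
      rcases k with _ | c₀ | c | _ | c <;>
      first
      | (exfalso; simp [rank] at hij hjk; done)
      | skip
    all_goals
      try fin_cases a₀
    all_goals
      try fin_cases b₀
    all_goals
      try fin_cases c₀
    all_goals
      simp [tableOneModFour, excess, pairExcess, splitExp, nonsplitExp, nonsplitSign,
        Fin.sum_univ_two, dualIndicator, h1, h1', hr']
      simp only [hr] at h2 h3 ⊢
      try field_simp
      try ring

end InterpolatedPSL2

namespace InterpolatedPSL2

-- Conjugation exchanges the two half-degree rows, their unipotent values being nonreal; hence the
-- duality `Fin.rev`.
set_option maxHeartbeats 2000000 in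
theorem tableThreeModFour_isFusionTable {q : ℕ} (hq : 2 ≤ q) (hq4 : q % 4 = 3) :
    FusionRing.IsFusionTable (tableThreeModFour q)
        (colWeight q ((q - 1) / 2) ((q + 1) / 2) (2 / (q * (q - 1) * (q + 1)))) .triv (dualRow Fin.rev)
        (mult ((q - 1) / 2) ((q + 1) / 2) [] [((q + 1) / 4 : ℕ)] 4 (dualIndicator Fin.rev)) ∧
      ∀ i j k : Row 2 ((q - 3) / 4) ((q - 3) / 4),
        2 * (mult ((q - 1) / 2) ((q + 1) / 2) [] [((q + 1) / 4 : ℕ)] 4 (dualIndicator Fin.rev) i j k : ℤ)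
          = doubleMult ((q - 1) / 2) ((q + 1) / 2) [] [((q + 1) / 4 : ℕ)] 4 (dualIndicator Fin.rev)
            i j k := by
  have hL : (q + 1) / 2 = 2 * ((q + 1) / 4) := by omega
  have hL0 : (q + 1) / 4 ≠ 0 := by omega
  have hqs : q - 1 = 2 * ((q - 1) / 2) := by omega
  have hqn : q + 1 = 2 * ((q + 1) / 2) := by omega
  refine isFusionTable_of_shape (L := (q + 1) / 4) Fin.rev_rev (by omega) (by omega) (by omega)
    (by omega) (by omega) (by norm_num) rfl (by simp) ?_ (fun j => rfl) ?_
    (fun a => Or.inl ⟨rfl, rfl, hL⟩) (fun x => by cases x <;> rfl) ?_ ?_ ?_ ?_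
  · intro e he
    rw [List.mem_singleton] at he
    rw [abs_le]
    omega
  · rw [hL]
    exact expSum_half_neg hL0
  · intro i x
    rcases i with _ | a₀ | a | _ | a <;> rcases x with _ | b | b | b
    case half.unipotent =>
      fin_cases a₀ <;> fin_cases b <;>
        simp [tableThreeModFour, dualRow, pow_succ]
    all_goals simp [tableThreeModFour, dualRow, star_zetaSum]
  · intro i k
    cases i with
    | plus c =>
      rw [splitExp, expSum_pair, ← zetaSum_two_mul (by omega), ← hqs]
      rfl
    | _ => simp [tableThreeModFour, splitExp, expSum]
  · intro i k
    cases i with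
    | half c =>
      rw [nonsplitExp, hL, neg_one_pow_expSum hL0, nonsplitSign, Int.cast_neg, Int.cast_one,
        ← pow_succ']
      rfl
    | minus c =>
      rw [nonsplitExp, expSum_pair, nonsplitSign, Int.cast_neg, Int.cast_one, neg_one_mul,
        ← zetaSum_two_mul (by omega), ← hqn]
      rfl
    | _ => simp [tableThreeModFour, nonsplitExp, expSum, nonsplitSign]
  · intro i j k hij hjk
    have h1 : (((q - 1) / 2 : ℕ) : ℂ) = ((q : ℂ) - 1) / 2 := by
      have := congrArg (Nat.cast : ℕ → ℂ) (show q = 2 * ((q - 1) / 2) + 1 by omega)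
      push_cast at this
      linear_combination - this / 2
    have h1' : (((q + 1) / 2 : ℕ) : ℂ) = ((q : ℂ) + 1) / 2 := by
      have := congrArg (Nat.cast : ℕ → ℂ) hqn
      push_cast at this
      linear_combination - this / 2
    have h2 : (q : ℂ) - 1 ≠ 0 := by
      intro h0
      rw [h0] at h1
      have : (q - 1) / 2 = 0 := by exact_mod_cast h1.trans (zero_div _)
      omega
    have h3 : (q : ℂ) + 1 ≠ 0 := by
      exact_mod_cast Nat.succ_ne_zero q
    have h4 : (q : ℂ) ≠ 0 := Nat.cast_ne_zero.2 (by omega)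
    -- With r = i√q the unipotent values of the half-degree rows are (-1 ± r)/2, which removes i
    -- from the identities.
    obtain ⟨r, hr', hr⟩ : ∃ r : ℂ, (Real.sqrt q : ℂ) = -(Complex.I * r) ∧ (q : ℂ) = -r ^ 2 := by
      refine ⟨Complex.I * (Real.sqrt q : ℂ), ?_, ?_⟩
      · rw [← mul_assoc, Complex.I_mul_I]
        ring
      · rw [mul_pow, Complex.I_sq, neg_one_mul, neg_neg]
        exact_mod_cast (Real.sq_sqrt (Nat.cast_nonneg q)).symm
    have hI : Complex.I * (Complex.I * r) = -r := by
      rw [← mul_assoc, Complex.I_mul_I, neg_one_mul]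
    have hr0 : r ≠ 0 := by
      rintro rfl
      simp at hr
      omega
    rcases i with _ | a₀ | a | _ | a <;> rcases j with _ | b₀ | b | _ | b <;>
      rcases k with _ | c₀ | c | _ | c <;>
      first
      | (exfalso; simp [rank] at hij hjk; done)
      | skip
    all_goals
      try fin_cases a₀
    all_goals
      try fin_cases b₀
    all_goals
      try fin_cases c₀
    all_goals
      simp [tableThreeModFour, excess, pairExcess, splitExp, nonsplitExp, nonsplitSign,
        Fin.sum_univ_two, dualIndicator, h1, h1', hr', hI, pow_succ]
      simp only [hr] at h2 h3 ⊢
      try field_simp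
      try ring

end InterpolatedPSL2

/-! ### The criterion for generic q -/

namespace InterpolatedPSL2

variable {h m p u s n : ℕ}

theorem tripleCount_nonneg (M : ℤ) (E F G : List ℤ) : 0 ≤ tripleCount M E F G := by
  refine List.sum_nonneg fun x hx => ?_
  obtain ⟨a, -, rfl⟩ := List.mem_map.1 hx
  refine List.sum_nonneg fun x hx => ?_
  obtain ⟨b, -, rfl⟩ := List.mem_map.1 hx
  refine List.sum_nonneg fun x hx => ?_
  obtain ⟨c, -, rfl⟩ := List.mem_map.1 hx
  unfold wrap
  split_ifs <;> simp

theorem tripleCount_nil (M : ℤ) (E F : List ℤ) : tripleCount M E F [] = 0 := by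
  simp [tripleCount]

/-- A row of degree q + 1 vanishes on the nonsplit columns, so only the nonnegative split count is
added. -/
theorem excess_le_doubleMult_plus (Ms Mn : ℕ) (hs hn : List ℤ) (c₀ : ℤ) (σ : Fin h → Fin h → ℤ)
    (i j : Row h m p) (c : Fin p) :
    excess c₀ σ i j (.plus c) ≤ doubleMult Ms Mn hs hn c₀ σ i j (.plus c) := by
  have h1 := tripleCount_nonneg Ms (splitExp hs i) (splitExp hs j)
    (splitExp hs (.plus c : Row h m p))
  rw [doubleMult, show nonsplitExp hn (.plus c : Row h m p) = [] from rfl, tripleCount_nil]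
  omega

/-- A row of degree q + 1 exists once q ≥ 4 and is universal. The Steinberg row is not: it does not
occur in the square of a row of degree q - 1. -/
theorem passes_even {q : ℕ} (hq : 4 ≤ q) (hq2 : q % 2 = 0) :
    (tableEven_isFusionTable (by omega) hq2).1.toFusionRing.PassesZeroSpectrumCriterion := by
  refine FusionRing.IsFusionTable.passes_of_universal _ (.plus ⟨0, by omega⟩) fun x y hx hy h0 => ?_
  have h1 := (tableEven_isFusionTable (by omega) hq2).2 x y (.plus ⟨0, by omega⟩)
  rw [h0] at h1
  have h2 := excess_le_doubleMult_plus (q - 1) (q + 1) [] [] 2 (dualIndicator id) x y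
    ⟨0, by omega⟩
  rcases x with _ | a | a | _ | a <;> rcases y with _ | b | b | _ | b <;>
    first
    | exact hx rfl
    | exact hy rfl
    | exact a.elim0
    | exact b.elim0
    | (simp only [excess] at h2
       omega)

/-- Here the Steinberg row is universal; for q = 5 there is no row of degree q + 1. -/
theorem passes_oneModFour {q : ℕ} (hq : 2 ≤ q) (hq4 : q % 4 = 1) :
    (tableOneModFour_isFusionTable hq hq4).1.toFusionRing.PassesZeroSpectrumCriterion := by
  refine FusionRing.IsFusionTable.passes_of_universal _ .steinberg fun x y hx hy h0 => ?_
  have h1 := (tableOneModFour_isFusionTable hq hq4).2 x y .steinberg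
  rw [h0] at h1
  rcases x with _ | a | a | _ | a <;> rcases y with _ | b | b | _ | b <;>
    first
    | exact hx rfl
    | exact hy rfl
    | skip
  all_goals
    simp only [doubleMult, excess, pairExcess, splitExp, nonsplitExp, nonsplitSign, tripleCount,
      List.map_cons, List.map_nil, List.sum_cons, List.sum_nil, wrap] at h1
    try have ha := a.isLt
    try have hb := b.isLt
    try split_ifs at h1
  all_goals omega

/-! ### The case q ≡ 3 mod 4, q ≥ 15 -/

section ThreeModFour

variable {q : ℕ}

/-- The triple multiplicities for `q ≡ 3 mod 4`. -/
abbrev multThree (q : ℕ) : Row 2 ((q - 3) / 4) ((q - 3) / 4) → Row 2 ((q - 3) / 4) ((q - 3) / 4) →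
    Row 2 ((q - 3) / 4) ((q - 3) / 4) → ℕ :=
  mult ((q - 1) / 2) ((q + 1) / 2) [] [((q + 1) / 4 : ℕ)] 4 (dualIndicator Fin.rev)

theorem two_mul_multThree (hq : 2 ≤ q) (hq4 : q % 4 = 3)
    (i j k : Row 2 ((q - 3) / 4) ((q - 3) / 4)) :
    2 * (multThree q i j k : ℤ) = doubleMult ((q - 1) / 2) ((q + 1) / 2) [] [((q + 1) / 4 : ℕ)] 4
      (dualIndicator Fin.rev) i j k :=
  (tableThreeModFour_isFusionTable hq hq4).2 i j k

theorem eq_rev_iff_ne : ∀ a b : Fin 2, b = Fin.rev a ↔ a ≠ b := by decide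

theorem multThree_plus_ne_zero (hq : 2 ≤ q) (hq4 : q % 4 = 3)
    {x y : Row 2 ((q - 3) / 4) ((q - 3) / 4)} (hx : x ≠ .triv) (hy : y ≠ .triv)
    (hxy : ¬ ∃ a, x = .half a ∧ y = .half a) (c : Fin ((q - 3) / 4)) :
    multThree q x y (.plus c) ≠ 0 := by
  intro h0
  have h1 := two_mul_multThree hq hq4 x y (.plus c)
  rw [h0] at h1
  have h2 := excess_le_doubleMult_plus ((q - 1) / 2) ((q + 1) / 2) [] [((q + 1) / 4 : ℕ)] 4
    (dualIndicator Fin.rev) x y c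
  rcases x with _ | a | a | _ | a <;> rcases y with _ | b | b | _ | b
  case half.half =>
    have hab : b = Fin.rev a :=
      (eq_rev_iff_ne a b).2 fun h3 => hxy ⟨a, rfl, congrArg _ h3.symm⟩
    simp only [excess, pairExcess, dualIndicator, if_pos hab] at h2
    omega
  all_goals
    first
    | exact hx rfl
    | exact hy rfl
    | (simp only [excess] at h2
       omega)

theorem multThree_half_half_minus (hq : 2 ≤ q) (hq4 : q % 4 = 3) (a : Fin 2)
    (c : Fin ((q - 3) / 4)) : multThree q (.half a) (.half a) (.minus c) ≠ 0 := by
  intro h0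
  have h1 := two_mul_multThree hq hq4 (.half a) (.half a) (.minus c)
  rw [h0] at h1
  have ha : a ≠ Fin.rev a := fun h3 => (eq_rev_iff_ne a a).1 h3 rfl
  simp only [doubleMult, excess, pairExcess, splitExp, nonsplitExp, nonsplitSign, tripleCount,
    List.map_cons, List.map_nil, List.sum_cons, List.sum_nil, wrap, dualIndicator, if_neg ha] at h1
  have hc := c.isLt
  split_ifs at h1 <;> omega

/-- The half-degree rows have nonsplit exponent L = (q+1)/4. In the product with row `minus b`, the
count cancels the excess exactly when the exponents b + 1 and c + 1 add up to L, which `hc`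
excludes. -/
theorem multThree_half_minus (hq : 2 ≤ q) (hq4 : q % 4 = 3) (a : Fin 2)
    {x : Row 2 ((q - 3) / 4) ((q - 3) / 4)} (hx : x ≠ .triv) (hx' : ∀ b, x ≠ .half b)
    (c : Fin ((q - 3) / 4)) (hc : ∀ b, x = .minus b → (b : ℕ) + c + 2 ≠ (q + 1) / 4) :
    multThree q (.half a) x (.minus c) ≠ 0 := by
  intro h0
  have h1 := two_mul_multThree hq hq4 (.half a) x (.minus c)
  rw [h0] at h1
  have hcl := c.isLt
  rcases x with _ | b | b | _ | b
  · exact hx rfl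
  · exact hx' b rfl
  · have hb := b.isLt
    have hbc := hc b rfl
    simp only [doubleMult, excess, splitExp, nonsplitExp, nonsplitSign, tripleCount,
      List.map_cons, List.map_nil, List.sum_cons, List.sum_nil, wrap] at h1
    split_ifs at h1 <;> omega
  · simp only [doubleMult, excess, splitExp, nonsplitExp, nonsplitSign, tripleCount,
      List.map_cons, List.map_nil, List.sum_cons, List.sum_nil, wrap] at h1
    split_ifs at h1 <;> omega
  · simp only [doubleMult, excess, splitExp, nonsplitExp, nonsplitSign, tripleCount,
      List.map_cons, List.map_nil, List.sum_cons, List.sum_nil] at h1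
    omega

/-- A half-degree row squared consists of its dual and rows of degree q - 1; multiplied by its dual
it consists of the trivial row and rows of degree q + 1. -/
theorem multThree_mul_eq_zero (hq : 2 ≤ q) (hq4 : q % 4 = 3) {a b : Fin 2} (hab : a ≠ b)
    (k : Row 2 ((q - 3) / 4) ((q - 3) / 4)) :
    multThree q (.half a) (.half a) (dualRow Fin.rev k) * multThree q (.half a) (.half b) k
      = 0 := by
  have h1 := two_mul_multThree hq hq4 (.half a) (.half a) (dualRow Fin.rev k)
  have h2 := two_mul_multThree hq hq4 (.half a) (.half b) k
  rw [mul_eq_zero]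
  have ha : a ≠ Fin.rev a := fun h3 => (eq_rev_iff_ne a a).1 h3 rfl
  have hb : b = Fin.rev a := (eq_rev_iff_ne a b).2 hab
  rcases k with _ | c | c | _ | c
  all_goals
    simp only [dualRow] at h1 ⊢
    simp only [doubleMult, excess, pairExcess, splitExp, nonsplitExp, nonsplitSign, tripleCount,
      List.map_cons, List.map_nil, List.sum_cons, List.sum_nil, wrap, dualIndicator,
      if_neg ha, if_pos hb, hab, false_and, if_false] at h1 h2
    try have hc := c.isLt
    try split_ifs at h1
    all_goals try split_ifs at h2
  all_goals omega

/-- Unless three of the four indices are the same half-degree row, they can be split into two pairs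
neither of which is such a row repeated, and two rows of degree q + 1 are common constituents. The
bound on q provides three rows of degree q - 1 for the exceptional case. -/
theorem passes_threeModFour (hq : 15 ≤ q) (hq4 : q % 4 = 3) :
    (tableThreeModFour_isFusionTable (by omega) hq4).1.toFusionRing.PassesZeroSpectrumCriterion := by
  have hq' : 2 ≤ q := by omega
  have H : FusionRing.IsFusionTable (tableThreeModFour q) _ .triv (dualRow Fin.rev) (multThree q) :=
    (tableThreeModFour_isFusionTable hq' hq4).1
  have hplus := @multThree_plus_ne_zero q hq' hq4
  have hk : ∀ k : Row 2 ((q - 3) / 4) ((q - 3) / 4),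
      ∀ c e, multThree q k c e = multThree q c e k := by
    intro k c e
    rw [H.swap_left, H.swap_right]
  have key : ∀ a b c e : Row 2 ((q - 3) / 4) ((q - 3) / 4), a ≠ .triv → b ≠ .triv → c ≠ .triv →
      e ≠ .triv → (¬ ∃ t, a = .half t ∧ b = .half t) → (¬ ∃ t, c = .half t ∧ e = .half t) →
      ∑ k, multThree q a b (dualRow Fin.rev k) * multThree q k c e ≠ 1 := by
    intro a b c e ha hb hc he hab hce
    refine FusionRing.IsFusionTable.contraction_ne_one_of_ne (d := dualRow Fin.rev)
      (n := multThree q) a b c e (.plus ⟨0, by omega⟩) (.plus ⟨1, by omega⟩)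
      (by simp) (hplus ha hb hab _) ?_ (hplus ha hb hab _) ?_
    · rw [hk]
      exact hplus hc he hce _
    · rw [hk]
      exact hplus hc he hce _
  have key' : ∀ (t : Fin 2) (x : Row 2 ((q - 3) / 4) ((q - 3) / 4)), x ≠ .triv →
      ∑ k, multThree q (.half t) (.half t) (dualRow Fin.rev k) * multThree q k (.half t) x
        ≠ 1 := by
    intro t x hx
    have hpair : ∀ c c' : Fin ((q - 3) / 4), c ≠ c' →
        multThree q (.half t) x (.minus c) ≠ 0 → multThree q (.half t) x (.minus c') ≠ 0 →
        ∑ k, multThree q (.half t) (.half t) (dualRow Fin.rev k) * multThree q k (.half t) x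
          ≠ 1 := by
      intro c c' hcc h1 h2
      refine FusionRing.IsFusionTable.contraction_ne_one_of_ne (d := dualRow Fin.rev)
        (n := multThree q) (.half t) (.half t) (.half t) x (.minus c) (.minus c')
        (by simpa using hcc) (multThree_half_half_minus hq' hq4 t c) ?_
        (multThree_half_half_minus hq' hq4 t c') ?_
      · rwa [hk]
      · rwa [hk]
    by_cases hxh : ∃ b, x = .half b
    · obtain ⟨b, rfl⟩ := hxh
      by_cases hb : t = b
      · subst hb
        exact hpair ⟨0, by omega⟩ ⟨1, by omega⟩ (by simp)
          (multThree_half_half_minus hq' hq4 _ _) (multThree_half_half_minus hq' hq4 _ _)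
      · rw [Finset.sum_eq_zero]
        · exact zero_ne_one
        · intro k _
          rw [hk k]
          exact multThree_mul_eq_zero hq' hq4 hb k
    · push Not at hxh
      have hm := @multThree_half_minus q hq' hq4 t x hx hxh
      by_cases hxm : ∃ b, x = .minus b
      · obtain ⟨b, rfl⟩ := hxm
        have hm' : ∀ c : Fin ((q - 3) / 4), (b : ℕ) + c + 2 ≠ (q + 1) / 4 →
            multThree q (.half t) (.minus b) (.minus c) ≠ 0 := by
          intro c hc
          refine hm c fun b' hb' => ?_
          rw [Row.minus.injEq] at hb'
          rwa [← hb']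
        -- At most one row of degree q - 1 is lost, so two of the first three remain; the cases are
        -- loss of index 0, of index 1, or of neither.
        by_cases h0 : (b : ℕ) + 2 = (q + 1) / 4
        · exact hpair ⟨1, by omega⟩ ⟨2, by omega⟩ (by simp) (hm' _ (by dsimp only; omega))
            (hm' _ (by dsimp only; omega))
        · by_cases h1 : (b : ℕ) + 3 = (q + 1) / 4
          · exact hpair ⟨0, by omega⟩ ⟨2, by omega⟩ (by simp) (hm' _ (by dsimp only; omega))
              (hm' _ (by dsimp only; omega))
          · exact hpair ⟨0, by omega⟩ ⟨1, by omega⟩ (by simp) (hm' _ (by dsimp only; omega))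
              (hm' _ (by dsimp only; omega))
      · push Not at hxm
        exact hpair ⟨0, by omega⟩ ⟨1, by omega⟩ (by simp) (hm _ fun b hb => absurd hb (hxm b))
          (hm _ fun b hb => absurd hb (hxm b))
  refine H.passes_of_contraction_ne_one fun a b c e ha hb hc he => ?_
  -- The contraction is symmetric in all four indices, so a bad pairing is repaired by exchanging b
  -- and c, or three equal half-degree rows are moved into the first three places.
  by_cases hab : ∃ t, a = .half t ∧ b = .half t
  · by_cases hac : ∃ t, a = .half t ∧ c = .half t
    · obtain ⟨t, rfl, rfl⟩ := hab
      obtain ⟨t', ht, rfl⟩ := hac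
      rw [Row.half.injEq] at ht
      subst ht
      exact key' t e he
    · by_cases hbe : ∃ t, b = .half t ∧ e = .half t
      · obtain ⟨t, rfl, rfl⟩ := hab
        obtain ⟨t', ht, rfl⟩ := hbe
        rw [Row.half.injEq] at ht
        subst ht
        rw [H.contraction_swap_mid, H.contraction_swap_left, H.contraction_swap_outer]
        exact key' t c hc
      · rw [H.contraction_swap_mid]
        exact key a c b e ha hc hb he hac hbe
  · by_cases hce : ∃ t, c = .half t ∧ e = .half t
    · by_cases hac : ∃ t, a = .half t ∧ c = .half t
      · obtain ⟨t, rfl, rfl⟩ := hce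
        obtain ⟨t', rfl, ht⟩ := hac
        rw [Row.half.injEq] at ht
        subst ht
        rw [H.contraction_swap_left, H.contraction_swap_outer]
        exact key' t b hb
      · by_cases hbe : ∃ t, b = .half t ∧ e = .half t
        · obtain ⟨t, rfl, rfl⟩ := hce
          obtain ⟨t', rfl, ht⟩ := hbe
          rw [Row.half.injEq] at ht
          subst ht
          rw [H.contraction_swap_outer]
          exact key' t a ha
        · rw [H.contraction_swap_mid]
          exact key a c b e ha hc hb he hac hbe
    · exact key a b c e ha hb hc he hab hce

end ThreeModFour

end InterpolatedPSL2

/-! ### Exhaustive search for the small values of q -/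

namespace FusionRing

/-- Entry `(a, b, c)` of a table of numbers below `4` that is given by one number for each `a`. -/
def lookup (tab : List ℕ) (r a b c : ℕ) : ℕ :=
  Nat.mod (Nat.div (tab.getD a 0) (Nat.pow 4 (Nat.add (Nat.mul r b) c))) 4

/-- The number of trivial constituents of a fourfold product, computed from a table. -/
def lookupContraction (tab : List ℕ) (D : ℕ → ℕ) (r a b c e : ℕ) : ℕ :=
  ((List.range r).map fun k => Nat.mul (lookup tab r a b (D k)) (lookup tab r k c e)).sum

/-- `lookupContraction` equals `1`; `pre` is a necessary condition that is tested first. -/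
def isSimpleContraction (tab : List ℕ) (D : ℕ → ℕ) (r : ℕ) (pre : ℕ → ℕ → ℕ → ℕ → Bool)
    (a b c e : ℕ) : Bool :=
  pre a b c e && Nat.beq (lookupContraction tab D r a b c e) 1

/-- No nontrivial indices satisfy the hypotheses of the zero spectrum criterion. -/
def noObstruction (tab : List ℕ) (D : ℕ → ℕ) (r : ℕ) (pre : ℕ → ℕ → ℕ → ℕ → Bool) : Bool :=
  let L := (List.range r).tail
  let N := lookup tab r
  let f := isSimpleContraction tab D r pre
  -- Each condition is tested as soon as its indices are chosen, which prunes the search; the tail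
  -- of the range omits the trivial index 0.
  L.all fun i₁ => L.all fun i₂ => L.all fun i₃ => !Nat.beq (N i₂ i₁ (D i₃)) 1 ||
  L.all fun i₄ => L.all fun i₆ => Nat.beq (N i₄ i₁ (D i₆)) 0 ||
  L.all fun i₅ => Nat.beq (N i₅ i₄ (D i₂)) 0 || (Nat.beq (N i₅ i₆ (D i₃)) 0 ||
    (!(f i₅ i₄ (D i₃) i₁ || (f i₂ (D i₄) (D i₃) i₆ || f (D i₅) i₂ (D i₆) i₁)) ||
  L.all fun i₇ => L.all fun i₉ => Nat.beq (N i₇ i₉ (D i₁)) 0 ||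
  L.all fun i₈ => Nat.beq (N i₂ i₇ (D i₈)) 0 || (Nat.beq (N i₈ i₉ (D i₃)) 0 ||
    ((List.range r).any (fun k => !Nat.beq (Nat.mul (Nat.mul (N i₄ i₇ (D k)) (N (D i₅) i₈ (D k)))
        (N i₆ (D i₉) (D k))) 0) ||
    !(f i₂ i₇ (D i₃) i₉ || (f i₈ (D i₇) (D i₃) i₁ || f (D i₂) i₈ (D i₁) i₉))))))

/-- `pre` is a necessary condition for a contraction to be `1`. -/
def isNecessary (tab : List ℕ) (D : ℕ → ℕ) (r : ℕ) (pre : ℕ → ℕ → ℕ → ℕ → Bool) : Bool :=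
  let L := (List.range r).tail
  L.all fun a => L.all fun b => L.all fun c => L.all fun e => pre a b c e ||
    !Nat.beq (lookupContraction tab D r a b c e) 1

/-- Three of four numbers are equal. -/
def threeEqual (a b c e : ℕ) : Bool :=
  (Nat.beq a b && (Nat.beq b c || Nat.beq b e)) || (Nat.beq c e && (Nat.beq a c || Nat.beq b c))

namespace IsFusionTable

variable {R κ : Type*} [Fintype R] [DecidableEq R] [Fintype κ] [DecidableEq κ]
  {T : R → κ → ℂ} {w : κ → ℝ} {t : R} {d : R → R} {n : R → R → R → ℕ}

theorem passes_of_noObstruction (h : IsFusionTable T w t d n) {tab : List ℕ} {D : ℕ → ℕ} {r : ℕ}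
    {pre : ℕ → ℕ → ℕ → ℕ → Bool} (code : R → ℕ) (hcode : Function.Injective code)
    (hlt : ∀ i, code i < r) (hr : Fintype.card R = r) (ht : code t = 0)
    (hn : ∀ i j k, n i j k = lookup tab r (code i) (code j) (code k))
    (hD : ∀ i, code (d i) = D (code i)) (hpre : isNecessary tab D r pre = true)
    (hno : noObstruction tab D r pre = true) :
    h.toFusionRing.PassesZeroSpectrumCriterion := by
  have hsurj : ∀ k, k < r → ∃ i, code i = k := by
    intro k hk
    have hb : Function.Bijective fun i => (⟨code i, hlt i⟩ : Fin r) :=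
      (Fintype.bijective_iff_injective_and_card _).2
        ⟨fun i j hij => hcode (Fin.mk.inj hij), by simp [hr]⟩
    obtain ⟨i, hi⟩ := hb.2 ⟨k, hk⟩
    exact ⟨i, congrArg Fin.val hi⟩
  have hmem : ∀ {i}, i ≠ t → code i ∈ (List.range r).tail := by
    intro i hi
    have h1 : code i ≠ 0 := fun h0 => hi (hcode (h0.trans ht.symm))
    have h2 := hlt i
    obtain ⟨r, rfl⟩ : ∃ r', r = r' + 1 := ⟨r - 1, by omega⟩
    rw [List.range_succ_eq_map, List.tail_cons, List.mem_map]
    exact ⟨code i - 1, List.mem_range.2 (by omega), by omega⟩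
  have hcon : ∀ a b c e, ∑ k, n a b (d k) * n k c e
      = lookupContraction tab D r (code a) (code b) (code c) (code e) := by
    intro a b c e
    rw [lookupContraction, ← List.sum_toFinset _ List.nodup_range, List.toFinset_range]
    refine Finset.sum_bij (fun k _ => code k) (fun k _ => Finset.mem_range.2 (hlt k))
      (fun i _ j _ hij => hcode hij) (fun k hk => ?_) fun k _ => ?_
    · obtain ⟨i, hi⟩ := hsurj k (Finset.mem_range.1 hk)
      exact ⟨i, Finset.mem_univ i, hi⟩
    · rw [hn, hn, hD]
      rfl
  have hd : ∀ {x}, x ≠ t → d x ≠ t := by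
    intro x hx h0
    rw [← h.dual_triv, h.dual_eq_iff] at h0
    exact hx h0
  -- The verified condition `isNecessary` guarantees that the filter `pre` discards no contraction
  -- equal to 1.
  have hf : ∀ a b c e, a ≠ t → b ≠ t → c ≠ t → e ≠ t → h.toFusionRing.pairing a b c (d e) = 1 →
      isSimpleContraction tab D r pre (code a) (code b) (D (code c)) (code e) = true := by
    intro a b c e ha hb hc he hp
    have h1 : h.toFusionRing.pairing a b c (d e) = ∑ k, n a b (d k) * n k (d c) e := by
      refine Finset.sum_congr rfl fun k _ => ?_
      change n a b (d k) * n c (d e) (d k) = n a b (d k) * n k (d c) e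
      rw [← h.dual_coeff k, h.dual_dual, h.swap_left (d k), h.swap_right c (d k)]
    rw [h1, hcon, hD] at hp
    have h2 := List.all_eq_true.1 (List.all_eq_true.1 (List.all_eq_true.1 (List.all_eq_true.1 hpre
      _ (hmem ha)) _ (hmem hb)) _ (hmem (hd hc))) _ (hmem he)
    rw [hD, hp] at h2
    rw [isSimpleContraction, hp]
    simpa using h2
  rintro ⟨i₁, i₂, i₃, i₄, i₅, i₆, i₇, i₈, i₉, H⟩
  obtain ⟨m1, m2, m3, m4, m5, m6, m7, m8, m9⟩ := h.obstruction_ne_triv H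
  obtain ⟨h1, h2, h3, h4, h5, h6⟩ : n i₄ i₁ (d i₆) ≠ 0 ∧ n i₅ i₄ (d i₂) ≠ 0 ∧
    n i₅ i₆ (d i₃) ≠ 0 ∧ n i₇ i₉ (d i₁) ≠ 0 ∧ n i₂ i₇ (d i₈) ≠ 0 ∧ n i₈ i₉ (d i₃) ≠ 0 :=
    H.nonvanishing
  have h7 : n i₂ i₁ (d i₃) = 1 := H.eq_one
  have hA := H.first_alternative.imp (hf _ _ _ _ m5 m4 m3 m1) (Or.imp
    (hf _ _ _ _ m2 (hd m4) m3 m6) (hf _ _ _ _ (hd m5) m2 m6 m1))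
  have hB := H.second_alternative.imp (hf _ _ _ _ m2 m7 m3 m9) (Or.imp
    (hf _ _ _ _ m8 (hd m7) m3 m1) (hf _ _ _ _ (hd m2) m8 m1 m9))
  rw [hn, hD] at h1 h2 h3 h4 h5 h6 h7
  rw [hD] at hA hB
  rw [hD] at hA hB
  have hvan : ((List.range r).any (fun k => !Nat.beq (Nat.mul (Nat.mul
      (lookup tab r (code i₄) (code i₇) (D k)) (lookup tab r (D (code i₅)) (code i₈) (D k)))
        (lookup tab r (code i₆) (D (code i₉)) (D k))) 0)) = false := by
    rw [List.any_eq_false]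
    intro k hk
    obtain ⟨i, rfl⟩ := hsurj k (List.mem_range.1 hk)
    have h0 : n i₄ i₇ (d i) * n (d i₅) i₈ (d i) * n i₆ (d i₉) (d i) = 0 :=
      Finset.sum_eq_zero_iff.1 H.vanishing i (Finset.mem_univ i)
    rw [hn, hn, hn, hD, hD, hD] at h0
    simpa using h0
  have e1 := List.all_eq_true.1 (List.all_eq_true.1 (List.all_eq_true.1 hno _ (hmem m1)) _
    (hmem m2)) _ (hmem m3)
  simp only [h7, Nat.beq_refl, Bool.not_true, Bool.false_or] at e1
  have e2 := List.all_eq_true.1 (List.all_eq_true.1 e1 _ (hmem m4)) _ (hmem m6)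
  simp only [Bool.or_eq_true, Nat.beq_eq, h1, false_or] at e2
  have e3 := List.all_eq_true.1 e2 _ (hmem m5)
  simp only [Bool.or_eq_true, Nat.beq_eq, h2, h3, false_or] at e3
  rcases e3 with e3 | e3
  · simp only [Bool.not_eq_true', ← Bool.not_eq_true, Bool.or_eq_true] at e3
    exact e3 hA
  have e4 := List.all_eq_true.1 (List.all_eq_true.1 e3 _ (hmem m7)) _ (hmem m9)
  simp only [Bool.or_eq_true, Nat.beq_eq, h4, false_or] at e4
  have e5 := List.all_eq_true.1 e4 _ (hmem m8)
  simp only [Bool.or_eq_true, Nat.beq_eq, h5, h6, false_or] at e5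
  rcases e5 with e5 | e5
  · exact Bool.false_ne_true (hvan.symm.trans e5)
  · simp only [Bool.not_eq_true', ← Bool.not_eq_true, Bool.or_eq_true] at e5
    exact e5 hB

end IsFusionTable

end FusionRing

namespace InterpolatedPSL2

variable {h m p : ℕ}

/-- The position of a row in the table. -/
def rowIndex : Row h m p → ℕ
  | .triv => 0
  | .half c => 1 + c
  | .minus c => 1 + h + c
  | .steinberg => 1 + h + m
  | .plus c => 2 + h + m + c

theorem rowIndex_lt (i : Row h m p) : rowIndex i < h + m + p + 2 := by
  cases i <;> simp only [rowIndex] <;> omega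

theorem rowIndex_injective : Function.Injective (rowIndex : Row h m p → ℕ) := by
  intro i j hij
  cases i <;> cases j <;> simp only [rowIndex] at hij <;> first | rfl | omega | (congr 1; omega)

/-- The transposition of `1` and `2`. -/
def swapOneTwo (a : ℕ) : ℕ := bif Nat.beq a 1 then 2 else bif Nat.beq a 2 then 1 else a

theorem swapOneTwo_of_three_le {a : ℕ} (ha : 3 ≤ a) : swapOneTwo a = a := by
  obtain ⟨n, rfl⟩ := Nat.exists_eq_add_of_le' ha
  rfl

theorem rowIndex_dualRow_id (i : Row h m p) : rowIndex (dualRow id i) = rowIndex i := by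
  cases i <;> rfl

theorem rowIndex_dualRow_rev (i : Row 2 m p) :
    rowIndex (dualRow Fin.rev i) = swapOneTwo (rowIndex i) := by
  rcases i with _ | c | c | _ | c
  · rfl
  · fin_cases c <;> rfl
  all_goals exact (swapOneTwo_of_three_le (by simp only [dualRow, rowIndex]; omega)).symm

/-- Entry a of `tab` is the sum of n(a,b,c) 4^(rb+c) over b and c, checked against `mult` by
evaluation. -/
theorem passes_two :
    (tableEven_isFusionTable (q := 2) le_rfl rfl).1.toFusionRing.PassesZeroSpectrumCriterion :=
  FusionRing.IsFusionTable.passes_of_noObstruction _ (tab := [65793, 65604, 87056]) (D := id)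
    (r := 3) (pre := fun _ _ _ _ => true) rowIndex rowIndex_injective rowIndex_lt card_row rfl
    (by decide +kernel) rowIndex_dualRow_id (by decide +kernel) (by decide +kernel)

theorem passes_three :
    (tableThreeModFour_isFusionTable (q := 3) (by norm_num)
      rfl).1.toFusionRing.PassesZeroSpectrumCriterion :=
  FusionRing.IsFusionTable.passes_of_noObstruction _
    (tab := [1074008065, 1073808400, 1074790660, 2504015936]) (D := swapOneTwo)
    (r := 4) (pre := fun _ _ _ _ => true) rowIndex rowIndex_injective rowIndex_lt card_row rfl
    (by decide +kernel) rowIndex_dualRow_rev (by decide +kernel) (by decide +kernel)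

theorem passes_seven :
    (tableThreeModFour_isFusionTable (q := 7) (by norm_num)
      rfl).1.toFusionRing.PassesZeroSpectrumCriterion :=
  FusionRing.IsFusionTable.passes_of_noObstruction _
    (tab := [1180663682709562916865, 1568351636887016062992, 1554516579640517070852,
      3122855821530000015424, 4303465752621512655104, 4600054532604761015296]) (D := swapOneTwo)
    (r := 6) (pre := fun _ _ _ _ => true) rowIndex rowIndex_injective rowIndex_lt card_row rfl
    (by decide +kernel) rowIndex_dualRow_rev (by decide +kernel) (by decide +kernel)

/-- Here there are only two rows of degree q - 1, too few for the generic argument. The filter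
`threeEqual` records that a contraction of nontrivial rows is 1 only if three of them coincide. -/
theorem passes_eleven :
    (tableThreeModFour_isFusionTable (q := 11) (by norm_num)
      rfl).1.toFusionRing.PassesZeroSpectrumCriterion :=
  FusionRing.IsFusionTable.passes_of_noObstruction _
    (tab := [85070916250026219054240312574197366785, 113401493759853945508518836316359884816,
      113339185246813577627168639301321818116, 226740679006614331211065283164368011328,
      226740679006382195410176469701725782272, 311811595255481182509412681524155778048,
      333080297957517944830706381095009521664, 253332053831823889061311801046779052032])
    (D := swapOneTwo)
    (r := 8) (pre := FusionRing.threeEqual) rowIndex rowIndex_injective rowIndex_lt card_row rfl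
    (by decide +kernel) rowIndex_dualRow_rev (by decide +kernel) (by decide +kernel)

end InterpolatedPSL2

/-! ### Transfer to an arbitrary labelling and conclusion -/

namespace FusionRing.IsFusionTable

variable {R κ : Type*} [Fintype R] [DecidableEq R] [Fintype κ] [DecidableEq κ]
  {T : R → κ → ℂ} {w : κ → ℝ} {t : R} {d : R → R} {n : R → R → R → ℕ}

/-- A fusion ring with a given table of characters exists on an initial segment of `ℕ`. -/
theorem exists_isEigentable (h : IsFusionTable T w t d n) :
    ∃ (r : ℕ) (F : FusionRing (Fin r)) (e : Fin r ≃ R), F.IsEigentable fun i => T (e i) := by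
  refine ⟨Fintype.card R, h.toFusionRing.map (Fintype.equivFin R), (Fintype.equivFin R).symm,
    FusionRing.IsEigentable.map ?_⟩
  simpa using h.isEigentable

/-- The zero spectrum criterion only depends on the table of characters. -/
theorem passes_of_isEigentable
    (h : IsFusionTable T w t d n) (hp : h.toFusionRing.PassesZeroSpectrumCriterion)
    {ι : Type*} [Fintype ι] [DecidableEq ι] {F : FusionRing ι} {e : ι ≃ R}
    (hF : F.IsEigentable fun i => T (e i)) : F.PassesZeroSpectrumCriterion :=
  FusionRing.PassesZeroSpectrumCriterion.of_map (e := e)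
    ((h.eq_toFusionRing (FusionRing.IsEigentable.map hF)).symm ▸ hp)

end FusionRing.IsFusionTable

namespace InterpolatedPSL2

theorem tableEven_passes {q : ℕ} (hq : 2 ≤ q) (hq2 : q % 2 = 0) :
    (tableEven_isFusionTable hq hq2).1.toFusionRing.PassesZeroSpectrumCriterion := by
  obtain rfl | h4 : q = 2 ∨ 4 ≤ q := by omega
  · exact passes_two
  · exact passes_even h4 hq2

theorem tableThreeModFour_passes {q : ℕ} (hq : 2 ≤ q) (hq4 : q % 4 = 3) :
    (tableThreeModFour_isFusionTable hq hq4).1.toFusionRing.PassesZeroSpectrumCriterion := by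
  obtain rfl | rfl | rfl | h15 : q = 3 ∨ q = 7 ∨ q = 11 ∨ 15 ≤ q := by omega
  · exact passes_three
  · exact passes_seven
  · exact passes_eleven
  · exact passes_threeModFour h15 hq4

end InterpolatedPSL2

open InterpolatedPSL2 in
theorem exists_isInterpolatedFusionRing {q : ℕ} (hq : 2 ≤ q) :
    ∃ (r : ℕ) (F : FusionRing (Fin r)), IsInterpolatedFusionRing q F := by
  obtain h | h | h : q % 2 = 0 ∨ q % 4 = 3 ∨ q % 4 = 1 := by omega
  · obtain ⟨r, F, e, hF⟩ := (tableEven_isFusionTable hq h).1.exists_isEigentable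
    exact ⟨r, F, .inl ⟨h, e, hF⟩⟩
  · obtain ⟨r, F, e, hF⟩ := (tableThreeModFour_isFusionTable hq h).1.exists_isEigentable
    exact ⟨r, F, .inr (.inl ⟨h, e, hF⟩)⟩
  · obtain ⟨r, F, e, hF⟩ := (tableOneModFour_isFusionTable hq h).1.exists_isEigentable
    exact ⟨r, F, .inr (.inr ⟨h, e, hF⟩)⟩

theorem proposition7p11 (q : ℕ) (hq : 2 ≤ q) :
    (∃ (r : ℕ) (F : FusionRing (Fin r)), InterpolatedPSL2.IsInterpolatedFusionRing q F) ∧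
    ∀ {ι : Type*} [Fintype ι] [DecidableEq ι] (F : FusionRing ι),
      InterpolatedPSL2.IsInterpolatedFusionRing q F → F.PassesZeroSpectrumCriterion := by
  refine ⟨exists_isInterpolatedFusionRing hq, fun F hF => ?_⟩
  rcases hF with ⟨h, e, hF⟩ | ⟨h, e, hF⟩ | ⟨h, e, hF⟩
  · exact (InterpolatedPSL2.tableEven_isFusionTable hq h).1.passes_of_isEigentable
      (InterpolatedPSL2.tableEven_passes hq h) hF
  · exact (InterpolatedPSL2.tableThreeModFour_isFusionTable hq h).1.passes_of_isEigentable
      (InterpolatedPSL2.tableThreeModFour_passes hq h) hF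
  · exact (InterpolatedPSL2.tableOneModFour_isFusionTable hq h).1.passes_of_isEigentable
      (InterpolatedPSL2.passes_oneModFour hq h) hF
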